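/- Let $Q\subset\mathbb{R}^d$ be a convex polytope, let $\phi:Q\to[0,1]$ be a measurable uncertainty density, and let $N$ be a number of robots. A configuration is a tuple $\mathcal{P}=(p_1,\dots,p_N)\in Q^N$ with $p_i\neq p_j$ for $i\neq j$. Its Voronoi cells are $V_i=\{q\in Q:\|q-p_i\|\le\|q-p_j\|\ \text{for all } j\}$. Let $k\in(0,1)$, $\alpha>0$, let $R>0$ be the sensor range and $k_{prop}>0$ the control gain. Put $\beta(r)=1-ke^{-\alpha r^2}$, and let $\tilde\beta(r)=\beta(r)$ for $r<R$, $\tilde\beta(r)=\beta(R)$ for $r\ge R$, and $\hat\beta(r)=\tilde\beta(r)+(1-\beta(R))$, so that $\hat\beta=1$ beyond $R$. The range-limited objective function is $$\hat{\mathcal H}(\mathcal P)=\sum_{i=1}^N\int_{V_i}\phi(q)\,\bigl(1-\hat\beta(\|p_i-q\|)\bigr)\,dq .$$ Let $\tilde M_i$ and $\tilde C_i=\tilde C_{V_i\cap\bar B(p_i,R)}$ be the mass and the centroid of the range-limited cell $V_i\cap\bar B(p_i,R)$ with respect to the perceived density $q\mapsto\phi(q)ke^{-\alpha\|p_i-q\|^2}$.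 Assume that $\tilde M_i>0$ for every configuration and every $i$, so that the centroids are defined (for instance $Q$ has non-empty interior and $\phi>0$ on $Q$). A critical point of $\hat{\mathcal H}$ is a configuration at which $\hat{\mathcal H}$, as a function of $(p_1,\dots,p_N)\in(\mathbb{R}^d)^N$, is differentiable with zero derivative. Then: 1. A configuration is a critical point of $\hat{\mathcal H}$ if and only if $p_i=\tilde C_{V_i\cap\bar B(p_i,R)}$ for all $i$. 2. Every solution $\mathcal P(t)$, $t\ge 0$, of $\dot p_i=u_i$ with the control law $$u_i=-k_{prop}\bigl(p_i-\tilde C_{V_i\cap\bar B(p_i,R)}\bigr),\qquad i=1,\dots,N,$$ that starts from a configuration $\mathcal P(0)$ (any one) remains a configuration for all $t\ge0$ and converges asymptotically to the set of critical points of $\hat{\mathcal H}$: the distance from $\mathcal P(t)$ to this set, which is non-empty whenever such a solution exists, tends to $0$ as $t\to\infty$. -/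

import Mathlib

open MeasureTheory Filter Topology

noncomputable section

namespace RangeSearch

/-- The `d`-dimensional Euclidean space. -/
abbrev Space (d : ℕ) := EuclideanSpace ℝ (Fin d)

/-- A tuple of positions of `N` robots. -/
abbrev Positions (N d : ℕ) := Fin N → Space d

/-- `Q` is a convex polytope: the convex hull of finitely many points. -/
def IsConvexPolytope {d : ℕ} (Q : Set (Space d)) : Prop :=
  ∃ s : Set (Space d), s.Finite ∧ Q = convexHull ℝ s

/-- The robot configurations in `Q`: all robots lie in `Q`, at pairwise distinct positions. -/
def configurations {d : ℕ} (N : ℕ) (Q : Set (Space d)) : Set (Positions N d) :=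
  {P | (∀ i, P i ∈ Q) ∧ ∀ i j, i ≠ j → P i ≠ P j}

/-- The Voronoi cell `V_i` of the `i`-th robot in `Q`. -/
def voronoiCell {N d : ℕ} (Q : Set (Space d)) (P : Positions N d) (i : Fin N) :
    Set (Space d) :=
  {q | q ∈ Q ∧ ∀ j, ‖q - P i‖ ≤ ‖q - P j‖}

/-- The range-limited Voronoi cell `V_i ∩ B̄(p_i, R)`. -/
def rangeCell {N d : ℕ} (Q : Set (Space d)) (R : ℝ) (P : Positions N d) (i : Fin N) :
    Set (Space d) :=
  voronoiCell Q P i ∩ Metric.closedBall (P i) R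

/-- The detection function `β(r) = 1 - k e^{-α r²}`. -/
def detection (k α r : ℝ) : ℝ := 1 - k * Real.exp (-α * r ^ 2)

/-- The detection function saturated at the range `R`. -/
def saturatedDetection (k α R r : ℝ) : ℝ :=
  if r < R then detection k α r else detection k α R

/-- The range-limited detection function `β̂`: the saturated one, shifted so that it is `1`
beyond the range `R`. -/
def rangeDetection (k α R r : ℝ) : ℝ :=
  saturatedDetection k α R r + (1 - detection k α R)

/-- The range-limited objective function `Ĥ`, the multi-center objective function of `β̂`. -/
def objective {N d : ℕ} (Q : Set (Space d)) (φ : Space d → ℝ) (k α R : ℝ)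
    (P : Positions N d) : ℝ :=
  ∑ i, ∫ q in voronoiCell Q P i, φ q * (1 - rangeDetection k α R ‖P i - q‖)

/-- The density `φ̃` as perceived by a sensor at `p`. -/
def perceivedDensity {d : ℕ} (φ : Space d → ℝ) (k α : ℝ) (p q : Space d) : ℝ :=
  φ q * (k * Real.exp (-α * ‖p - q‖ ^ 2))

/-- The mass `M̃` of `V_i ∩ B̄(p_i, R)` with respect to the perceived density. -/
def cellMass {N d : ℕ} (Q : Set (Space d)) (φ : Space d → ℝ) (k α R : ℝ)
    (P : Positions N d) (i : Fin N) : ℝ :=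
  ∫ q in rangeCell Q R P i, perceivedDensity φ k α (P i) q

/-- The centroid `C̃` of `V_i ∩ B̄(p_i, R)` with respect to the perceived density
(meaningful when the mass is nonzero). -/
def cellCentroid {N d : ℕ} (Q : Set (Space d)) (φ : Space d → ℝ) (k α R : ℝ)
    (P : Positions N d) (i : Fin N) : Space d :=
  (cellMass Q φ k α R P i)⁻¹ •
    ∫ q in rangeCell Q R P i, perceivedDensity φ k α (P i) q • q

/-- The control law `u_i = -k_prop (p_i - C̃)`. -/
def control {N d : ℕ} (Q : Set (Space d)) (φ : Space d → ℝ) (k α R kprop : ℝ)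
    (P : Positions N d) (i : Fin N) : Space d :=
  -(kprop • (P i - cellCentroid Q φ k α R P i))

/-- `P` is a trajectory, on the time interval `[0, ∞)`, of the closed loop `ṗ_i = u_i`. -/
def IsTrajectory {N d : ℕ} (Q : Set (Space d)) (φ : Space d → ℝ) (k α R kprop : ℝ)
    (P : ℝ → Positions N d) : Prop :=
  ∀ t : ℝ, 0 ≤ t → ∀ i,
    HasDerivWithinAt (fun s => P s i) (control Q φ k α R kprop (P t) i) (Set.Ici 0) t

/-- The critical points of `Ĥ`: the configurations in `Q` at which `Ĥ` is differentiable, as a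
function of the positions in the ambient space, with vanishing derivative. -/
def criticalPoints {d : ℕ} (N : ℕ) (Q : Set (Space d)) (φ : Space d → ℝ) (k α R : ℝ) :
    Set (Positions N d) :=
  {P | P ∈ configurations N Q ∧
    HasFDerivAt (objective Q φ k α R) (0 : Positions N d →L[ℝ] ℝ) P}

end RangeSearch

end

/-! The sensor contribution `1 - β̂` does not increase with distance, so on the cell of a robot it
is the largest contribution of all robots. For distinct positions `Ĥ(P)` is therefore the integral
over the fixed domain `Q` of a maximum over the robots (`objective_eq_integral_bestGain`). The
integrand is Lipschitz in `P` and differentiable off the bisectors and the spheres of radius `R`,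
which are null. Differentiation under the integral sign gives, without boundary terms, the gradient
components `-2α M̃_i (p_i - C̃_i)` (`hasFDerivAt_objective`). This yields the critical points, and
shows that the control law is an ascent: `dĤ/dt = 2α k_prop ∑ M̃_i ‖p_i - C̃_i‖²`.

A LaSalle argument needs the trajectory to stay in a compact set of configurations, whereas
distinctness is not a closed condition. In finite time no collision occurs: the bisector of two
robots separates their cells, hence their centroids, so squared distances decay at most
exponentially (`IsTrajectory.mem_configurations`). This does not exclude a merger as `t → ∞`. For
that, consider a group `S` of robots of small diameter `D`, isolated from all others. The union of
its cells keeps a mass bounded below, and splitting it by bisectors makes the centroids repel the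
robots at a rate of at least `c D` (`exists_le_sum_inner_cellCentroid`). The contraction of the
spread is only of order `D²`, so a small spread grows. Downward induction on the size of `S`
provides the isolation: if all larger groups have spread bounded below, a tight group has no robot
nearby (`IsTrajectory.exists_le_spread`). Groups of two give a uniform separation, hence
compactness. -/

noncomputable section

namespace RangeSearch

/-! ### The measure with density `φ` on `Q` -/

section Density

variable {d : ℕ} {Q : Set (Space d)} {φ : Space d → ℝ}

/-- The measure on `Q` whose density with respect to the Lebesgue measure is `φ`. -/
def densityMeasure (Q : Set (Space d)) (φ : Space d → ℝ) : Measure (Space d) :=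
  (volume.restrict Q).withDensity fun q => ENNReal.ofReal (φ q)

theorem densityMeasure_absolutelyContinuous : densityMeasure Q φ ≪ volume :=
  (withDensity_absolutelyContinuous _ _).trans Measure.restrict_le_self.absolutelyContinuous

theorem ae_densityMeasure_mem (hQ : MeasurableSet Q) : ∀ᵐ q ∂densityMeasure Q φ, q ∈ Q :=
  (withDensity_absolutelyContinuous _ _).ae_le (ae_restrict_mem hQ)

theorem isFiniteMeasure_densityMeasure (hQ : IsCompact Q) (hφ : ∀ q ∈ Q, φ q ∈ Set.Icc (0 : ℝ) 1) :
    IsFiniteMeasure (densityMeasure Q φ) := by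
  refine isFiniteMeasure_withDensity (ne_of_lt ?_)
  calc ∫⁻ q in Q, ENNReal.ofReal (φ q) ≤ ∫⁻ _ in Q, 1 := by
        refine setLIntegral_mono' hQ.measurableSet fun q hq => ?_
        exact ENNReal.ofReal_le_one.2 (hφ q hq).2
    _ < ⊤ := by simpa using hQ.measure_lt_top

theorem setIntegral_densityMeasure {F : Type*} [NormedAddCommGroup F] [NormedSpace ℝ F]
    (hQ : MeasurableSet Q) (hφ : ∀ q ∈ Q, φ q ∈ Set.Icc (0 : ℝ) 1)
    (hφm : AEMeasurable φ (volume.restrict Q)) {A : Set (Space d)} (hA : MeasurableSet A)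
    (g : Space d → F) :
    ∫ q in A, g q ∂densityMeasure Q φ = ∫ q in Q ∩ A, φ q • g q := by
  rw [densityMeasure, setIntegral_withDensity_eq_setIntegral_toReal_smul₀
    hφm.ennreal_ofReal.restrict (by simp) _ hA, Measure.restrict_restrict hA, Set.inter_comm]
  refine setIntegral_congr_fun (hQ.inter hA) fun q hq => ?_
  simp only [ENNReal.toReal_ofReal (hφ q hq.1).1]

end Density

/-! ### Continuity of integrals over moving regions -/

section Support

variable {d : ℕ} {Q : Set (Space d)} {ν : Measure (Space d)} [IsFiniteMeasure ν]
  {F : Type*} [NormedAddCommGroup F]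

theorem integrable_of_continuous_of_compact_support (hQ : IsCompact Q) (hν : ∀ᵐ q ∂ν, q ∈ Q)
    {h : Space d → F} (hh : Continuous h) : Integrable h ν := by
  obtain ⟨B, hB⟩ := hQ.exists_bound_of_continuousOn hh.continuousOn
  exact (integrable_const B).mono' hh.aestronglyMeasurable (hν.mono fun q hq => hB q hq)

/-- The integral of a continuous family of functions over a moving region is continuous where the
boundary of the region is a null set. -/
theorem continuousAt_setIntegral_of_null_boundary [NormedSpace ℝ F] {X ι : Type*} [TopologicalSpace X]
    [FirstCountableTopology X] [Finite ι] (hQ : IsCompact Q) (hν : ∀ᵐ q ∂ν, q ∈ Q)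
    {g : ι → X → Space d → ℝ} (hg : ∀ l, Continuous fun z : X × Space d => g l z.1 z.2)
    {h : X → Space d → F} (hh : Continuous fun z : X × Space d => h z.1 z.2) {x₀ : X}
    (hnull : ∀ l, ν {q | g l x₀ q = 0} = 0) :
    ContinuousAt (fun x => ∫ q in {q | ∀ l, g l x q ≤ 0}, h x q ∂ν) x₀ := by
  have hgq : ∀ l x, Continuous (g l x) := fun l x => (hg l).comp (Continuous.prodMk_right x)
  have hgx : ∀ l q, Continuous fun x => g l x q := fun l q => (hg l).comp (Continuous.prodMk_left q)
  have hA : ∀ x, MeasurableSet {q | ∀ l, g l x q ≤ 0} := fun x => by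
    rw [Set.ofPred_forall]
    exact (isClosed_iInter fun l => isClosed_le (hgq l x) continuous_const).measurableSet
  simp_rw [← integral_indicator (hA _)]
  obtain ⟨B, hB⟩ := hQ.exists_bound_of_continuousOn
    (f := h x₀) (hh.comp (Continuous.prodMk_right x₀)).continuousOn
  have hbound : ∀ᶠ x in 𝓝 x₀, ∀ q ∈ Q, ‖h x q‖ < B + 1 := by
    refine hQ.eventually_forall_of_forall_eventually fun q hq => ?_
    exact hh.norm.continuousAt.eventually_lt continuousAt_const ((hB q hq).trans_lt (lt_add_one B))
  refine continuousAt_of_dominated (bound := fun _ => B + 1) ?_ ?_ (integrable_const _) ?_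
  · exact Eventually.of_forall fun x =>
      (hh.comp (Continuous.prodMk_right x)).aestronglyMeasurable.indicator (hA x)
  · filter_upwards [hbound] with x hx
    filter_upwards [hν] with q hq
    exact (norm_indicator_le_norm_self _ _).trans (hx q hq).le
  -- Almost every `q` either satisfies all constraints strictly at `x₀` or violates one strictly.
  -- Both persist near `x₀`, so the indicator is locally constant in `x`.
  · have : ∀ᵐ q ∂ν, ∀ l, g l x₀ q ≠ 0 := ae_all_iff.2 fun l => by
      rw [ae_iff]; simpa using hnull l
    filter_upwards [this] with q hq
    by_cases hmem : ∀ l, g l x₀ q < 0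
    · have hev : ∀ᶠ x in 𝓝 x₀, ∀ l, g l x q < 0 := eventually_all.2 fun l =>
        (hgx l q).continuousAt.eventually_lt continuousAt_const (hmem l)
      refine ContinuousAt.congr (f := fun x => h x q)
        (hh.comp (Continuous.prodMk_left q)).continuousAt ?_
      filter_upwards [hev] with x hx
      rw [Set.indicator_of_mem]
      exact fun l => (hx l).le
    · push Not at hmem
      obtain ⟨l, hl⟩ := hmem
      have hev : ∀ᶠ x in 𝓝 x₀, 0 < g l x q :=
        continuousAt_const.eventually_lt (hgx l q).continuousAt (lt_of_le_of_ne hl (hq l).symm)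
      refine ContinuousAt.congr (f := fun _ => (0 : F)) continuousAt_const ?_
      filter_upwards [hev] with x hx
      rw [Set.indicator_of_notMem]
      exact fun hx' => (hx' l).not_gt hx

end Support

/-! ### Spheres, bisectors and hyperplanes are null -/

section NullSets

variable {d : ℕ} {ν : Measure (Space d)}

theorem measure_sphere_eq_zero (hν : ν ≪ volume) (p : Space d) {R : ℝ} (hR : R ≠ 0) :
    ν {q | ‖q - p‖ = R} = 0 :=
  hν (by simpa [Metric.sphere, dist_eq_norm] using
    Measure.addHaar_sphere_of_ne_zero (μ := volume) p hR)

theorem measure_bisector_eq_zero (hν : ν ≪ volume) {p p' : Space d} (h : p ≠ p') :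
    ν {q | ‖q - p‖ = ‖q - p'‖} = 0 := by
  refine hν ?_
  have := Measure.addHaar_affineSubspace volume (AffineSubspace.perpBisector p p')
    (by simpa using h)
  convert! this using 2
  ext q
  simp [AffineSubspace.mem_perpBisector_iff_dist_eq, dist_eq_norm]

theorem measure_hyperplane_eq_zero (hν : ν ≪ volume) (c : Space d) {e : Space d} (he : e ≠ 0) :
    ν {q | inner ℝ (q - c) e = 0} = 0 := by
  convert! measure_bisector_eq_zero hν (p := c + e) (p' := c - e) ?_ using 2
  · ext q
    have h1 := norm_sub_sq_real (q - c) e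
    have h2 := norm_add_sq_real (q - c) e
    rw [Set.mem_ofPred_eq, Set.mem_ofPred_eq, ← sub_sub, ← sub_add,
      ← sq_eq_sq₀ (norm_nonneg _) (norm_nonneg _)]
    constructor <;> intro h <;> linarith
  · intro h
    have : (2 : ℝ) • e = 0 := by
      rw [two_smul, ← sub_eq_zero.2 h]
      abel
    simp [he] at this

end NullSets

/-! ### Range-limited cells of robots and of groups -/

section Cells

variable {N d : ℕ}

/-- The points within the range `R` of the robot `a` to which no robot outside the group `S` is
closer than `a`. -/
def limitedCell (R : ℝ) (S : Finset (Fin N)) (a : Fin N) (P : Positions N d) : Set (Space d) :=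
  {q | ∀ l, ‖q - P a‖ - (if l ∈ S then R else ‖q - P l‖) ≤ 0}

/-- The factor `k e^{-α ‖p - q‖²}` by which a sensor at `p` perceives the density at `q`. -/
def sensing (k α : ℝ) (p q : Space d) : ℝ := k * Real.exp (-α * ‖p - q‖ ^ 2)

@[fun_prop]
theorem continuous_sensing {X : Type*} [TopologicalSpace X] (k α : ℝ) {f g : X → Space d}
    (hf : Continuous f) (hg : Continuous g) : Continuous fun x => sensing k α (f x) (g x) := by
  unfold sensing; fun_prop

theorem sensing_pos {k : ℝ} (hk : 0 < k) (α : ℝ) (p q : Space d) : 0 < sensing k α p q :=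
  mul_pos hk (Real.exp_pos _)

theorem continuous_gap {X : Type*} [TopologicalSpace X] (R : ℝ) (S : Finset (Fin N)) (a l : Fin N)
    {p : X → Positions N d} {q : X → Space d} (hp : Continuous p) (hq : Continuous q) :
    Continuous fun x => ‖q x - p x a‖ - (if l ∈ S then R else ‖q x - p x l‖) := by
  split_ifs <;> fun_prop

theorem measurableSet_limitedCell (R : ℝ) (S : Finset (Fin N)) (a : Fin N) (P : Positions N d) :
    MeasurableSet (limitedCell R S a P) := by
  rw [limitedCell, Set.ofPred_forall]
  exact (isClosed_iInter fun l => isClosed_le (continuous_gap R S a l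
    continuous_const continuous_id) continuous_const).measurableSet

/-- With `a ∈ S`, the inequality of index `a` is the range condition; the other indices in `S` only
repeat it. -/
theorem mem_limitedCell {R : ℝ} {S : Finset (Fin N)} {a : Fin N} {P : Positions N d} {q : Space d}
    (ha : a ∈ S) :
    q ∈ limitedCell R S a P ↔ ‖q - P a‖ ≤ R ∧ ∀ l ∉ S, ‖q - P a‖ ≤ ‖q - P l‖ := by
  simp only [limitedCell, Set.mem_ofPred_eq, sub_nonpos]
  refine ⟨fun h => ⟨by simpa [ha] using h a, fun l hl => by simpa [hl] using h l⟩, fun h l => ?_⟩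
  split_ifs with hl
  · exact h.1
  · exact h.2 l hl

theorem mem_limitedCell_singleton {R : ℝ} {a : Fin N} {P : Positions N d} {q : Space d} :
    q ∈ limitedCell R {a} a P ↔ ‖q - P a‖ ≤ R ∧ ∀ l, ‖q - P a‖ ≤ ‖q - P l‖ := by
  rw [mem_limitedCell (Finset.mem_singleton_self a)]
  refine and_congr_right fun _ => ⟨fun h l => ?_, fun h l _ => h l⟩
  by_cases hl : l = a
  · rw [hl]
  · exact h l (by simpa using hl)

theorem rangeCell_eq (Q : Set (Space d)) (R : ℝ) (P : Positions N d) (i : Fin N) :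
    rangeCell Q R P i = Q ∩ limitedCell R {i} i P := by
  ext q
  rw [rangeCell, voronoiCell, Set.mem_inter_iff, Set.mem_inter_iff, mem_limitedCell_singleton,
    Set.mem_ofPred_eq, mem_closedBall_iff_norm]
  tauto

/-- Integrals over limited cells depend continuously on the positions and on parameters. -/
theorem continuousAt_setIntegral_limitedCell {Q : Set (Space d)} {ν : Measure (Space d)}
    [IsFiniteMeasure ν] {F Y : Type*} [NormedAddCommGroup F] [NormedSpace ℝ F]
    [TopologicalSpace Y] [FirstCountableTopology Y]
    (hQ : IsCompact Q) (hν : ∀ᵐ q ∂ν, q ∈ Q) (hac : ν ≪ volume) {R : ℝ} (hR : R ≠ 0)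
    {S : Finset (Fin N)} {a : Fin N} {P : Positions N d} (hP : ∀ l ∉ S, P a ≠ P l)
    {h : Positions N d × Y → Space d → F}
    (hh : Continuous fun z : (Positions N d × Y) × Space d => h z.1 z.2) (y : Y) :
    ContinuousAt (fun x => ∫ q in limitedCell R S a x.1, h x q ∂ν) (P, y) := by
  refine continuousAt_setIntegral_of_null_boundary (X := Positions N d × Y) hQ hν
    (g := fun l x q => ‖q - x.1 a‖ - (if l ∈ S then R else ‖q - x.1 l‖)) (fun l => ?_) hh
    fun l => ?_
  · exact continuous_gap R S a l (continuous_fst.comp continuous_fst) continuous_snd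
  · simp only [sub_eq_zero]
    split_ifs with hl
    · exact measure_sphere_eq_zero hac _ hR
    · exact measure_bisector_eq_zero hac (hP l hl)

end Cells

/-- The standing assumptions on the polytope, the density and the sensors. -/
structure Admissible {d : ℕ} (Q : Set (Space d)) (φ : Space d → ℝ) (k α R : ℝ) : Prop where
  isCompact : IsCompact Q
  convex : Convex ℝ Q
  mem_Icc : ∀ q ∈ Q, φ q ∈ Set.Icc (0 : ℝ) 1
  aemeasurable : AEMeasurable φ (volume.restrict Q)
  k_pos : 0 < k
  α_pos : 0 < α
  R_pos : 0 < R

/-! ### Mass, moment and centroid of a range-limited cell -/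

section Centroid

variable {N d : ℕ} {Q : Set (Space d)} {φ : Space d → ℝ} {k α R : ℝ}

namespace Admissible

theorem isFiniteMeasure (H : Admissible Q φ k α R) : IsFiniteMeasure (densityMeasure Q φ) :=
  isFiniteMeasure_densityMeasure H.isCompact H.mem_Icc

theorem ae_mem (H : Admissible Q φ k α R) : ∀ᵐ q ∂densityMeasure Q φ, q ∈ Q :=
  ae_densityMeasure_mem H.isCompact.measurableSet

theorem integrable (H : Admissible Q φ k α R) {F : Type*} [NormedAddCommGroup F]
    {h : Space d → F} (hh : Continuous h) : Integrable h (densityMeasure Q φ) :=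
  have := H.isFiniteMeasure
  integrable_of_continuous_of_compact_support H.isCompact H.ae_mem hh

end Admissible

theorem cellMass_eq (H : Admissible Q φ k α R) (P : Positions N d) (i : Fin N) :
    cellMass Q φ k α R P i =
      ∫ q in limitedCell R {i} i P, sensing k α (P i) q ∂densityMeasure Q φ := by
  rw [setIntegral_densityMeasure H.isCompact.measurableSet H.mem_Icc H.aemeasurable
    (measurableSet_limitedCell _ _ _ _), ← rangeCell_eq]
  rfl

/-- The first moment of a range-limited cell with respect to the perceived density. -/
def cellMoment (Q : Set (Space d)) (φ : Space d → ℝ) (k α R : ℝ) (P : Positions N d) (i : Fin N) :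
    Space d :=
  ∫ q in limitedCell R {i} i P, sensing k α (P i) q • q ∂densityMeasure Q φ

theorem cellCentroid_eq (H : Admissible Q φ k α R) (P : Positions N d) (i : Fin N) :
    cellCentroid Q φ k α R P i = (cellMass Q φ k α R P i)⁻¹ • cellMoment Q φ k α R P i := by
  rw [cellMoment, setIntegral_densityMeasure H.isCompact.measurableSet H.mem_Icc H.aemeasurable
    (measurableSet_limitedCell _ _ _ _), ← rangeCell_eq, cellCentroid]
  simp only [perceivedDensity, sensing, smul_smul]

theorem cellMass_smul_cellCentroid (H : Admissible Q φ k α R) {P : Positions N d} {i : Fin N}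
    (hM : 0 < cellMass Q φ k α R P i) :
    cellMass Q φ k α R P i • cellCentroid Q φ k α R P i = cellMoment Q φ k α R P i := by
  rw [cellCentroid_eq H, smul_inv_smul₀ hM.ne']

theorem continuousAt_cellMass (H : Admissible Q φ k α R) {P : Positions N d}
    (hP : ∀ i j, i ≠ j → P i ≠ P j) (i : Fin N) :
    ContinuousAt (fun P => cellMass Q φ k α R P i) P := by
  have := H.isFiniteMeasure
  simp_rw [cellMass_eq H]
  refine (continuousAt_setIntegral_limitedCell (Y := Unit) H.isCompact H.ae_mem
    densityMeasure_absolutelyContinuous H.R_pos.ne' (S := {i}) (a := i)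
    (h := fun z q => sensing k α (z.1 i) q)
    (fun l hl => hP i l fun h => hl (by simp [h])) (by fun_prop) ()).comp
    (f := fun P => (P, ())) (Continuous.prodMk_left ()).continuousAt

theorem continuousAt_cellMoment (H : Admissible Q φ k α R) {P : Positions N d}
    (hP : ∀ i j, i ≠ j → P i ≠ P j) (i : Fin N) :
    ContinuousAt (fun P => cellMoment Q φ k α R P i) P := by
  have := H.isFiniteMeasure
  refine (continuousAt_setIntegral_limitedCell (Y := Unit) H.isCompact H.ae_mem
    densityMeasure_absolutelyContinuous H.R_pos.ne' (S := {i}) (a := i)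
    (h := fun z q => sensing k α (z.1 i) q • q)
    (fun l hl => hP i l fun h => hl (by simp [h])) (by fun_prop) ()).comp
    (f := fun P => (P, ())) (Continuous.prodMk_left ()).continuousAt

theorem continuousAt_cellCentroid (H : Admissible Q φ k α R) {P : Positions N d}
    (hP : ∀ i j, i ≠ j → P i ≠ P j) {i : Fin N} (hM : 0 < cellMass Q φ k α R P i) :
    ContinuousAt (fun P => cellCentroid Q φ k α R P i) P := by
  simp_rw [cellCentroid_eq H]
  exact ((continuousAt_cellMass H hP i).inv₀ hM.ne').smul (continuousAt_cellMoment H hP i)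

/-- Affine functionals at the centroid are averages over the cell. -/
theorem apply_cellCentroid_sub (H : Admissible Q φ k α R) {P : Positions N d} {i : Fin N}
    (hM : 0 < cellMass Q φ k α R P i) (f : Space d →L[ℝ] ℝ) (c : ℝ) :
    f (cellCentroid Q φ k α R P i) - c = (cellMass Q φ k α R P i)⁻¹ *
      ∫ q in limitedCell R {i} i P, sensing k α (P i) q * (f q - c) ∂densityMeasure Q φ := by
  have h1 : f (cellMoment Q φ k α R P i) =
      ∫ q in limitedCell R {i} i P, sensing k α (P i) q * f q ∂densityMeasure Q φ := by
    rw [cellMoment, ← f.integral_comp_comm (H.integrable (by fun_prop)).integrableOn]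
    simp
  have h2 : c * cellMass Q φ k α R P i =
      ∫ q in limitedCell R {i} i P, sensing k α (P i) q * c ∂densityMeasure Q φ := by
    rw [integral_mul_const, cellMass_eq H, mul_comm]
  simp_rw [mul_sub]
  rw [integral_sub (H.integrable (by fun_prop)).integrableOn
    (H.integrable (by fun_prop)).integrableOn, ← h1, ← h2, cellCentroid_eq H, map_smul,
    smul_eq_mul]
  field_simp

theorem apply_cellCentroid_le (H : Admissible Q φ k α R) {P : Positions N d} {i : Fin N}
    (hM : 0 < cellMass Q φ k α R P i) (f : Space d →L[ℝ] ℝ) {c : ℝ} (hf : ∀ q ∈ Q, f q ≤ c) :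
    f (cellCentroid Q φ k α R P i) ≤ c := by
  rw [← sub_nonpos, apply_cellCentroid_sub H hM]
  refine mul_nonpos_of_nonneg_of_nonpos (inv_nonneg.2 hM.le) ?_
  refine integral_nonpos_of_ae (ae_restrict_of_ae ?_)
  filter_upwards [H.ae_mem] with q hq
  exact mul_nonpos_of_nonneg_of_nonpos (sensing_pos H.k_pos _ _ _).le (sub_nonpos.2 (hf q hq))

/-- A centroid is an average of points of `Q`, so no functional can separate it strictly from the
closed convex set `Q`. -/
theorem cellCentroid_mem (H : Admissible Q φ k α R) {P : Positions N d} {i : Fin N}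
    (hM : 0 < cellMass Q φ k α R P i) : cellCentroid Q φ k α R P i ∈ Q := by
  by_contra h
  obtain ⟨f, u, hu, hu'⟩ := geometric_hahn_banach_closed_point H.convex H.isCompact.isClosed h
  exact hu'.not_ge (apply_cellCentroid_le H hM f fun q hq => (hu q hq).le)

end Centroid

/-! ### The objective as the integral of a maximum -/

section Gain

variable {N d : ℕ} {Q : Set (Space d)} {φ : Space d → ℝ} {k α R : ℝ}

/-- The contribution `1 - β̂(‖p - q‖)` of a robot at `p` to the objective function at `q`. -/
def gain (k α R : ℝ) (p q : Space d) : ℝ :=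
  max 0 (sensing k α p q - k * Real.exp (-α * R ^ 2))

theorem gain_eq_of_le (hk : 0 < k) (hα : 0 < α) {p q : Space d} (h : ‖p - q‖ ≤ R) :
    gain k α R p q = sensing k α p q - k * Real.exp (-α * R ^ 2) := by
  have h2 : ‖p - q‖ ^ 2 ≤ R ^ 2 := by gcongr
  refine max_eq_right (sub_nonneg.2 (mul_le_mul_of_nonneg_left (Real.exp_le_exp.2 ?_) hk.le))
  nlinarith

theorem gain_eq_zero (hk : 0 < k) (hα : 0 < α) {p q : Space d} (hR : 0 ≤ R) (h : R ≤ ‖p - q‖) :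
    gain k α R p q = 0 := by
  have h2 : R ^ 2 ≤ ‖p - q‖ ^ 2 := by gcongr
  refine max_eq_left (sub_nonpos.2 (mul_le_mul_of_nonneg_left (Real.exp_le_exp.2 ?_) hk.le))
  nlinarith

theorem one_sub_rangeDetection (H : Admissible Q φ k α R) (p q : Space d) :
    1 - rangeDetection k α R ‖p - q‖ = gain k α R p q := by
  rw [rangeDetection, saturatedDetection]
  split_ifs with h
  · rw [gain_eq_of_le H.k_pos H.α_pos h.le, detection, detection, sensing]
    ring
  · rw [gain_eq_zero H.k_pos H.α_pos H.R_pos.le (not_lt.1 h)]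
    ring

theorem gain_nonneg (p q : Space d) : 0 ≤ gain k α R p q := le_max_left _ _

theorem gain_le (H : Admissible Q φ k α R) (p q : Space d) : gain k α R p q ≤ k := by
  refine max_le H.k_pos.le ?_
  have h1 : Real.exp (-α * ‖p - q‖ ^ 2) ≤ 1 := Real.exp_le_one_iff.2 (by
    have := mul_nonneg H.α_pos.le (sq_nonneg ‖p - q‖)
    linarith)
  have h2 := mul_le_mul_of_nonneg_left h1 H.k_pos.le
  have h3 := mul_pos H.k_pos (Real.exp_pos (-α * R ^ 2))
  rw [sensing]
  linarith

theorem gain_le_gain (H : Admissible Q φ k α R) {p p' q : Space d} (h : ‖q - p‖ ≤ ‖q - p'‖) :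
    gain k α R p' q ≤ gain k α R p q := by
  refine max_le_max le_rfl (sub_le_sub_right (mul_le_mul_of_nonneg_left
    (Real.exp_le_exp.2 ?_) H.k_pos.le) _)
  have h2 : ‖p - q‖ ^ 2 ≤ ‖p' - q‖ ^ 2 := by
    rw [norm_sub_rev p q, norm_sub_rev p' q]; gcongr
  nlinarith [H.α_pos]

theorem measurable_gain (p : Space d) : Measurable (gain k α R p) := by
  have : Continuous (gain k α R p) := by unfold gain; fun_prop
  exact this.measurable

theorem hasFDerivAt_sensing (p q : Space d) :
    HasFDerivAt (fun p => sensing k α p q)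
      ((-2 * α * sensing k α p q) • innerSL ℝ (p - q)) p := by
  have h1 : HasFDerivAt (fun p : Space d => ‖p - q‖ ^ 2) (2 • innerSL ℝ (p - q)) p := by
    simpa using ((hasFDerivAt_id p).sub_const q).norm_sq
  have h2 := ((h1.const_mul (-α)).exp).const_mul k
  refine h2.congr_fderiv ?_
  ext v
  simp [sensing]
  ring

theorem norm_sensing_sub_le (H : Admissible Q φ k α R) (p p' q : Space d) :
    |sensing k α p q - sensing k α p' q| ≤ k * (1 + α) * ‖p - p'‖ := by
  have hb : ∀ p : Space d, ‖(-2 * α * sensing k α p q) • innerSL ℝ (p - q)‖ ≤ k * (1 + α) := by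
    intro p
    have hα := H.α_pos
    have hk := H.k_pos
    rw [norm_smul, innerSL_apply_norm, Real.norm_eq_abs, abs_mul, abs_of_neg (by linarith),
      abs_of_pos (sensing_pos hk _ _ _), sensing]
    set r := ‖p - q‖
    have hr : 0 ≤ r := norm_nonneg _
    have he : 1 + α * r ^ 2 ≤ Real.exp (α * r ^ 2) := by
      linarith [Real.add_one_le_exp (α * r ^ 2)]
    have hexp : Real.exp (-α * r ^ 2) * Real.exp (α * r ^ 2) = 1 := by
      rw [← Real.exp_add]; simp
    -- The difference `(1 + α)(1 + α r²) - 2 α r` equals `1 + α (r - 1)² + α² r²`. The resulting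
    -- Lipschitz constant is not sharp, but it does not depend on `q`.
    have h1 : 2 * α * r ≤ (1 + α) * Real.exp (α * r ^ 2) := by
      have h3 : 2 * α * r ≤ (1 + α) * (1 + α * r ^ 2) := by
        nlinarith [mul_nonneg hα.le (sq_nonneg (r - 1)), mul_nonneg (sq_nonneg α) (sq_nonneg r)]
      exact h3.trans (mul_le_mul_of_nonneg_left he (by linarith))
    have h2 := mul_le_mul_of_nonneg_left h1
      (mul_nonneg hk.le (Real.exp_pos (-α * r ^ 2)).le)
    calc -(-2 * α) * (k * Real.exp (-α * r ^ 2)) * r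
        = k * Real.exp (-α * r ^ 2) * (2 * α * r) := by ring
      _ ≤ k * Real.exp (-α * r ^ 2) * ((1 + α) * Real.exp (α * r ^ 2)) := h2
      _ = k * (1 + α) * (Real.exp (-α * r ^ 2) * Real.exp (α * r ^ 2)) := by ring
      _ = k * (1 + α) := by rw [hexp, mul_one]
  have := convex_univ.norm_image_sub_le_of_norm_hasFDerivWithin_le
    (f := fun p => sensing k α p q) (fun p _ => (hasFDerivAt_sensing p q).hasFDerivWithinAt)
    (fun p _ => hb p) (Set.mem_univ p') (Set.mem_univ p)
  simpa using this

theorem gain_le_gain_add (H : Admissible Q φ k α R) (p p' q : Space d) :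
    gain k α R p q ≤ gain k α R p' q + k * (1 + α) * ‖p - p'‖ := by
  have h0 : 0 ≤ k * (1 + α) * ‖p - p'‖ := by
    have := H.k_pos
    have := H.α_pos
    positivity
  have h1 := le_of_abs_le (norm_sensing_sub_le H p p' q)
  refine max_le (add_nonneg (gain_nonneg _ _) h0) ?_
  have h2 : sensing k α p' q - k * Real.exp (-α * R ^ 2) ≤ gain k α R p' q := le_max_right _ _
  linarith

/-- The largest contribution of a robot at the point `q`. -/
def bestGain (k α R : ℝ) (P : Positions N d) (q : Space d) : ℝ := ⨆ i, gain k α R (P i) q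

theorem bestGain_eq (H : Admissible Q φ k α R) {P : Positions N d} {q : Space d} {i : Fin N}
    (h : ∀ j, ‖q - P i‖ ≤ ‖q - P j‖) : bestGain k α R P q = gain k α R (P i) q :=
  have : Nonempty (Fin N) := ⟨i⟩
  le_antisymm (ciSup_le fun j => gain_le_gain H (h j))
    (le_ciSup (f := fun j => gain k α R (P j) q) (Set.finite_range _).bddAbove i)

theorem bestGain_nonneg (P : Positions N d) (q : Space d) : 0 ≤ bestGain k α R P q :=
  Real.iSup_nonneg fun _ => gain_nonneg _ _

theorem bestGain_le (H : Admissible Q φ k α R) (P : Positions N d) (q : Space d) :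
    bestGain k α R P q ≤ k :=
  Real.iSup_le (fun _ => gain_le H _ _) H.k_pos.le

theorem bestGain_le_add (H : Admissible Q φ k α R) (P P' : Positions N d) (q : Space d) :
    bestGain k α R P q ≤ bestGain k α R P' q + k * (1 + α) * dist P P' := by
  have hk := H.k_pos
  have hα := H.α_pos
  refine Real.iSup_le (fun i => (gain_le_gain_add H (P i) (P' i) q).trans ?_)
    (add_nonneg (bestGain_nonneg _ _) (by positivity))
  refine add_le_add (le_ciSup (f := fun j => gain k α R (P' j) q) (Set.finite_range _).bddAbove i)
    (mul_le_mul_of_nonneg_left ?_ (by positivity))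
  rw [← dist_eq_norm]
  exact dist_le_pi_dist P P' i

theorem measurable_bestGain (P : Positions N d) : Measurable (bestGain k α R P) :=
  Measurable.iSup fun _ => measurable_gain _

theorem integrable_bestGain (H : Admissible Q φ k α R) (P : Positions N d) :
    Integrable (bestGain k α R P) (densityMeasure Q φ) := by
  have := H.isFiniteMeasure
  refine (integrable_const k).mono' (measurable_bestGain P).aestronglyMeasurable
    (Eventually.of_forall fun q => ?_)
  rw [Real.norm_eq_abs, abs_of_nonneg (bestGain_nonneg _ _)]
  exact bestGain_le H P q

theorem measurableSet_closer (P : Positions N d) (i : Fin N) :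
    MeasurableSet {q | ∀ j, ‖q - P i‖ ≤ ‖q - P j‖} := by
  rw [Set.ofPred_forall]
  exact (isClosed_iInter fun l => isClosed_le (by fun_prop) (by fun_prop)).measurableSet

theorem exists_closest (hN : N ≠ 0) (P : Positions N d) (q : Space d) :
    ∃ i, ∀ j, ‖q - P i‖ ≤ ‖q - P j‖ :=
  have : Nonempty (Fin N) := ⟨⟨0, Nat.pos_of_ne_zero hN⟩⟩
  Finite.exists_min fun i => ‖q - P i‖

/-- The nearest robot has the largest gain, and cells of distinct robots overlap only in bisectors.
The dependence on moving domains thus disappears. -/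
theorem objective_eq_integral_bestGain (H : Admissible Q φ k α R) (hN : N ≠ 0)
    {P : Positions N d} (hP : ∀ i j, i ≠ j → P i ≠ P j) :
    objective Q φ k α R P = ∫ q, bestGain k α R P q ∂densityMeasure Q φ := by
  have hV : ⋃ i, {q | ∀ j, ‖q - P i‖ ≤ ‖q - P j‖} = Set.univ := by
    refine Set.eq_univ_of_forall fun q => Set.mem_iUnion.2 ?_
    exact exists_closest hN P q
  rw [← setIntegral_univ, ← hV, integral_iUnion_ae
    (fun i => (measurableSet_closer P i).nullMeasurableSet) ?_ (integrable_bestGain H P).integrableOn,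
    tsum_fintype, objective]
  · refine Finset.sum_congr rfl fun i _ => ?_
    rw [setIntegral_congr_fun (measurableSet_closer P i) fun q hq => bestGain_eq H hq,
      setIntegral_densityMeasure H.isCompact.measurableSet H.mem_Icc H.aemeasurable
        (measurableSet_closer P i)]
    simp_rw [one_sub_rangeDetection H]
    rfl
  · intro i j hij
    refine measure_mono_null (fun q hq => ?_) (measure_bisector_eq_zero
      (densityMeasure_absolutelyContinuous (Q := Q) (φ := φ)) (hP i j hij))
    exact le_antisymm (hq.1 j) (hq.2 i)

end Gain

/-! ### The gradient of the objective and its critical points -/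

section Gradient

variable {N d : ℕ} {Q : Set (Space d)} {φ : Space d → ℝ} {k α R : ℝ}

/-- The functional `v ↦ ⟪x, v i⟫` on tuples, as a linear function of `x`. -/
def innerProj (i : Fin N) : Space d →L[ℝ] (Positions N d →L[ℝ] ℝ) :=
  LinearMap.toContinuousLinearMap
    { toFun := fun x => (innerSL ℝ x).comp (ContinuousLinearMap.proj i)
      map_add' := fun x y => by ext v; simp
      map_smul' := fun c x => by ext v; simp }

@[simp]
theorem innerProj_apply (i : Fin N) (x : Space d) (v : Positions N d) :
    innerProj i x v = inner ℝ x (v i) := rfl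

theorem eventually_distinct {P : Positions N d} (hP : ∀ i j, i ≠ j → P i ≠ P j) :
    ∀ᶠ P' in 𝓝 P, ∀ i j, i ≠ j → P' i ≠ P' j := by
  refine eventually_all.2 fun i => eventually_all.2 fun j => ?_
  by_cases hij : i = j
  · simp [hij]
  · filter_upwards [IsOpen.mem_nhds (s := {P : Positions N d | P i ≠ P j})
      (isOpen_ne_fun (continuous_apply i) (continuous_apply j)) (hP i j hij)] with P' h _ using h

theorem continuous_norm_sub_apply (q : Space d) (i : Fin N) :
    Continuous fun P : Positions N d => ‖q - P i‖ :=
  (continuous_const.sub (continuous_apply i)).norm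

/-- The density of the derivative of the objective function. -/
def gradientDensity (k α R : ℝ) (P : Positions N d) (q : Space d) : Positions N d →L[ℝ] ℝ :=
  ∑ i, innerProj i ((limitedCell R {i} i P).indicator
    (fun q => (-2 * α) • sensing k α (P i) q • (P i - q)) q)

/-- Off the spheres and bisectors, the nearest robot and whether it is within range do not change
under small moves. Locally the maximum is thus one smooth term, or zero. -/
theorem hasFDerivAt_bestGain (H : Admissible Q φ k α R) (hN : N ≠ 0) {P : Positions N d}
    {q : Space d} (hR : ∀ i, ‖q - P i‖ ≠ R) (hq : ∀ i j, i ≠ j → ‖q - P i‖ ≠ ‖q - P j‖) :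
    HasFDerivAt (fun P => bestGain k α R P q) (gradientDensity k α R P q) P := by
  obtain ⟨i, hi⟩ := exists_closest hN P q
  have hlt : ∀ j, j ≠ i → ‖q - P i‖ < ‖q - P j‖ := fun j hj =>
    lt_of_le_of_ne (hi j) (hq i j hj.symm)
  have hev : ∀ᶠ P' : Positions N d in 𝓝 P, ∀ j, ‖q - P' i‖ ≤ ‖q - P' j‖ := by
    refine eventually_all.2 fun j => ?_
    by_cases hj : j = i
    · simp [hj]
    · exact ((continuous_norm_sub_apply q i).continuousAt.eventually_lt
        (continuous_norm_sub_apply q j).continuousAt (hlt j hj)).mono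
        fun _ h => h.le
  have hG : gradientDensity k α R P q = innerProj i ((limitedCell R {i} i P).indicator
      (fun q => (-2 * α) • sensing k α (P i) q • (P i - q)) q) := by
    refine Finset.sum_eq_single i (fun j _ hj => ?_) (by simp)
    rw [Set.indicator_of_notMem, map_zero]
    rw [mem_limitedCell_singleton]
    exact fun h => (h.2 i).not_gt (hlt j hj)
  rw [hG]
  rcases lt_or_gt_of_ne (hR i) with hRi | hRi
  · have hev' : ∀ᶠ P' : Positions N d in 𝓝 P, ‖q - P' i‖ < R :=
      (continuous_norm_sub_apply q i).continuousAt.eventually_lt continuousAt_const hRi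
    rw [Set.indicator_of_mem (mem_limitedCell_singleton.2 ⟨hRi.le, hi⟩)]
    have hd : HasFDerivAt (fun P' : Positions N d =>
        sensing k α (P' i) q - k * Real.exp (-α * R ^ 2))
        (innerProj i ((-2 * α) • sensing k α (P i) q • (P i - q))) P := by
      refine ((HasFDerivAt.comp P (g := fun p => sensing k α p q) (hasFDerivAt_sensing (P i) q)
        (hasFDerivAt_apply i P)).sub_const _).congr_fderiv ?_
      ext v
      simp [mul_assoc]
    refine hd.congr_of_eventuallyEq ?_
    filter_upwards [hev, hev'] with P' h h'
    rw [bestGain_eq H h, gain_eq_of_le H.k_pos H.α_pos]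
    rw [norm_sub_rev]
    exact h'.le
  · have hev' : ∀ᶠ P' : Positions N d in 𝓝 P, R < ‖q - P' i‖ :=
      continuousAt_const.eventually_lt (continuous_norm_sub_apply q i).continuousAt hRi
    rw [Set.indicator_of_notMem (fun h => (mem_limitedCell_singleton.1 h).1.not_gt hRi), map_zero]
    refine (hasFDerivAt_const (0 : ℝ) P).congr_of_eventuallyEq ?_
    filter_upwards [hev, hev'] with P' h h'
    rw [bestGain_eq H h, gain_eq_zero H.k_pos H.α_pos H.R_pos.le]
    rw [norm_sub_rev]
    exact h'.le

theorem integrable_gradientDensity_term (H : Admissible Q φ k α R) (P : Positions N d)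
    (i : Fin N) : Integrable ((limitedCell R {i} i P).indicator
      fun q => (-2 * α) • sensing k α (P i) q • (P i - q)) (densityMeasure Q φ) :=
  (H.integrable (by fun_prop)).indicator (measurableSet_limitedCell _ _ _ _)

theorem integral_gradientDensity (H : Admissible Q φ k α R) (P : Positions N d) :
    ∫ q, gradientDensity k α R P q ∂densityMeasure Q φ =
      ∑ i, innerProj i ((-2 * α) •
        (cellMass Q φ k α R P i • P i - cellMoment Q φ k α R P i)) := by
  unfold gradientDensity
  rw [integral_finsetSum _ fun i _ =>
    (innerProj i).integrable_comp (integrable_gradientDensity_term H P i)]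
  refine Finset.sum_congr rfl fun i _ => ?_
  rw [(innerProj i).integral_comp_comm (integrable_gradientDensity_term H P i),
    integral_indicator (measurableSet_limitedCell _ _ _ _), integral_smul]
  simp_rw [smul_sub]
  rw [integral_sub (H.integrable (by fun_prop)).integrableOn
    (H.integrable (by fun_prop)).integrableOn, integral_smul_const, ← cellMass_eq H, smul_sub]
  rfl

/-- The gradient of the objective function. -/
theorem hasFDerivAt_objective (H : Admissible Q φ k α R) {P : Positions N d}
    (hP : ∀ i j, i ≠ j → P i ≠ P j) :
    HasFDerivAt (objective Q φ k α R) (∑ i, innerProj i ((-2 * α) •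
        (cellMass Q φ k α R P i • P i - cellMoment Q φ k α R P i))) P := by
  rcases eq_or_ne N 0 with rfl | hN
  · exact (hasFDerivAt_of_subsingleton _ _).congr_fderiv (by ext v; simp)
  have := H.isFiniteMeasure
  have hk := H.k_pos
  have hα := H.α_pos
  have hac := densityMeasure_absolutelyContinuous (Q := Q) (φ := φ)
  rw [← integral_gradientDensity H]
  have key := hasFDerivAt_integral_of_dominated_loc_of_lip (μ := densityMeasure Q φ)
    (F := bestGain k α R) (F' := gradientDensity k α R P) (x₀ := P)
    (bound := fun _ => k * (1 + α)) univ_mem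
    (Eventually.of_forall fun P => (measurable_bestGain P).aestronglyMeasurable)
    (integrable_bestGain H P) ?_ ?_ (integrable_const _) ?_
  -- The integral formula holds only at distinct positions, since coinciding robots would have their
  -- common cell counted repeatedly. Distinctness is an open condition, so this suffices.
  · refine key.2.congr_of_eventuallyEq ?_
    filter_upwards [eventually_distinct hP] with P' hP'
    exact objective_eq_integral_bestGain H hN hP'
  · unfold gradientDensity
    exact Finset.aestronglyMeasurable_fun_sum _ fun i _ => ((innerProj i).integrable_comp
      (integrable_gradientDensity_term H P i)).aestronglyMeasurable
  · refine Eventually.of_forall fun q => LipschitzWith.lipschitzOnWith ?_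
    refine LipschitzWith.of_le_add_mul _ fun P P' => ?_
    rw [Real.coe_nnabs, abs_of_nonneg (by positivity)]
    exact bestGain_le_add H P P' q
  · have h1 : ∀ᵐ q ∂densityMeasure Q φ, ∀ i, ‖q - P i‖ ≠ R := ae_all_iff.2 fun i => by
      rw [ae_iff]; simpa using measure_sphere_eq_zero hac (P i) H.R_pos.ne'
    have h2 : ∀ᵐ q ∂densityMeasure Q φ, ∀ i j, i ≠ j → ‖q - P i‖ ≠ ‖q - P j‖ :=
      ae_all_iff.2 fun i => ae_all_iff.2 fun j => by
        by_cases hij : i = j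
        · simp [hij]
        · rw [ae_iff]; simpa [hij] using measure_bisector_eq_zero hac (hP i j hij)
    filter_upwards [h1, h2] with q hq1 hq2
    exact hasFDerivAt_bestGain H hN hq1 hq2

theorem criticalPoints_eq (H : Admissible Q φ k α R)
    (hmass : ∀ P ∈ configurations N Q, ∀ i, 0 < cellMass Q φ k α R P i) :
    criticalPoints N Q φ k α R =
      {P | P ∈ configurations N Q ∧ ∀ i, P i = cellCentroid Q φ k α R P i} := by
  ext P
  refine and_congr_right fun hP => ?_
  have hd := hasFDerivAt_objective H hP.2
  have hterm : ∀ i, cellMass Q φ k α R P i • P i - cellMoment Q φ k α R P i =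
      cellMass Q φ k α R P i • (P i - cellCentroid Q φ k α R P i) := fun i => by
    rw [smul_sub, cellMass_smul_cellCentroid H (hmass P hP i)]
  constructor
  · intro h i
    -- Moving only robot `i`, in the direction `P i - C̃_i`, isolates a nonzero multiple of `‖P i -
    -- C̃_i‖²`.
    have h0 := DFunLike.congr_fun (hd.unique h) (Pi.single i (P i - cellCentroid Q φ k α R P i))
    rw [sum_apply, Finset.sum_eq_single i] at h0
    · rw [hterm, smul_smul, innerProj_apply, Pi.single_eq_same, real_inner_smul_left,
        zero_apply, mul_eq_zero, inner_self_eq_zero, sub_eq_zero] at h0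
      refine h0.resolve_left (mul_ne_zero ?_ (hmass P hP i).ne')
      exact mul_ne_zero (by norm_num) H.α_pos.ne'
    · intro j _ hj
      simp [hj]
    · simp
  · intro h
    refine hd.congr_fderiv (Finset.sum_eq_zero fun i _ => ?_)
    rw [hterm, ← h i, sub_self, smul_zero, smul_zero, map_zero]

end Gradient

/-- A Grönwall bound from below: `e^{Kt} h` is nondecreasing. It shows that a quantity positive at
time `0` cannot reach zero in finite time. -/
theorem exp_mul_le_of_neg_mul_le_deriv {h h' : ℝ → ℝ} {K T : ℝ} (hT : 0 ≤ T)
    (hc : ContinuousOn h (Set.Icc 0 T)) (hd : ∀ t ∈ Set.Ioo 0 T, HasDerivAt h (h' t) t)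
    (hb : ∀ t ∈ Set.Ioo 0 T, -K * h t ≤ h' t) : h 0 ≤ Real.exp (K * T) * h T := by
  have hmono : MonotoneOn (fun t => Real.exp (K * t) * h t) (Set.Icc 0 T) := by
    refine monotoneOn_of_hasDerivWithinAt_nonneg (convex_Icc 0 T)
      (ContinuousOn.mul (by fun_prop) hc)
      (f' := fun t => Real.exp (K * t) * K * h t + Real.exp (K * t) * h' t) ?_ ?_
    · intro t ht
      rw [interior_Icc] at ht
      have h1 : HasDerivAt (fun t => Real.exp (K * t)) (Real.exp (K * t) * K) t := by
        simpa using ((hasDerivAt_id t).const_mul K).exp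
      exact (h1.mul (hd t ht)).hasDerivWithinAt
    · intro t ht
      rw [interior_Icc] at ht
      have := mul_nonneg (Real.exp_pos (K * t)).le (by linarith [hb t ht] : 0 ≤ K * h t + h' t)
      linarith
  simpa using hmono (Set.left_mem_Icc.2 hT) (Set.right_mem_Icc.2 hT) hT

/-! ### Invariance of the set of configurations -/

section Invariance

variable {N d : ℕ} {Q : Set (Space d)} {φ : Space d → ℝ} {k α R kprop : ℝ}

theorem IsTrajectory.continuousOn {P : ℝ → Positions N d}
    (hP : IsTrajectory Q φ k α R kprop P) : ContinuousOn P (Set.Ici 0) := fun t ht =>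
  continuousWithinAt_pi.2 fun i => (hP t ht i).continuousWithinAt

theorem IsTrajectory.continuousOn_apply {P : ℝ → Positions N d}
    (hP : IsTrajectory Q φ k α R kprop P) (i : Fin N) :
    ContinuousOn (fun t => P t i) (Set.Ici 0) := fun t ht =>
  (hP t ht i).continuousWithinAt

theorem IsTrajectory.hasDerivAt {P : ℝ → Positions N d} (hP : IsTrajectory Q φ k α R kprop P)
    {t : ℝ} (ht : 0 < t) (i : Fin N) :
    HasDerivAt (fun s => P s i) (control Q φ k α R kprop (P t) i) t :=
  (hP t ht.le i).hasDerivAt (Ici_mem_nhds ht)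

theorem IsTrajectory.hasDerivWithinAt_sq_norm_sub {P : ℝ → Positions N d}
    (hP : IsTrajectory Q φ k α R kprop P) {t : ℝ} (ht : 0 ≤ t) (i j : Fin N) :
    HasDerivWithinAt (fun s => ‖P s i - P s j‖ ^ 2) (2 * kprop * (inner ℝ (P t i - P t j)
      (cellCentroid Q φ k α R (P t) i - cellCentroid Q φ k α R (P t) j)
        - ‖P t i - P t j‖ ^ 2)) (Set.Ici 0) t := by
  refine ((hP t ht i).sub (hP t ht j)).norm_sq.congr_deriv ?_
  rw [← real_inner_self_eq_norm_sq]
  simp only [control, Pi.sub_apply, inner_sub_left, inner_sub_right, inner_neg_right,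
    real_inner_smul_right]
  ring

/-- The signed distance from the centroid of the cell of `i` to the bisector of `i` and `j`,
times `‖P i - P j‖`. -/
theorem inner_cellCentroid_sub (H : Admissible Q φ k α R) {P : Positions N d} {i : Fin N}
    (hM : 0 < cellMass Q φ k α R P i) (j : Fin N) :
    inner ℝ (P i - P j) (cellCentroid Q φ k α R P i) - (‖P i‖ ^ 2 - ‖P j‖ ^ 2) / 2 =
      (cellMass Q φ k α R P i)⁻¹ * ∫ q in limitedCell R {i} i P,
        sensing k α (P i) q * ((‖q - P j‖ ^ 2 - ‖q - P i‖ ^ 2) / 2) ∂densityMeasure Q φ := by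
  have := apply_cellCentroid_sub H hM (innerSL ℝ (P i - P j)) ((‖P i‖ ^ 2 - ‖P j‖ ^ 2) / 2)
  rw [innerSL_apply_apply] at this
  rw [this]
  congr 2
  ext q
  rw [innerSL_apply_apply, norm_sub_sq_real, norm_sub_sq_real, inner_sub_left,
    real_inner_comm q (P i), real_inner_comm q (P j)]
  ring

theorem inner_cellCentroid_sub_nonneg (H : Admissible Q φ k α R) {P : Positions N d} {i : Fin N}
    (hM : 0 < cellMass Q φ k α R P i) (j : Fin N) :
    0 ≤ inner ℝ (P i - P j) (cellCentroid Q φ k α R P i) - (‖P i‖ ^ 2 - ‖P j‖ ^ 2) / 2 := by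
  rw [inner_cellCentroid_sub H hM]
  refine mul_nonneg (inv_nonneg.2 hM.le) (setIntegral_nonneg (measurableSet_limitedCell _ _ _ _)
    fun q hq => mul_nonneg (sensing_pos H.k_pos _ _ _).le ?_)
  have : ‖q - P i‖ ^ 2 ≤ ‖q - P j‖ ^ 2 := by
    have := (mem_limitedCell_singleton.1 hq).2 j
    gcongr
  linarith

/-- Each centroid lies on its own robot's side of the bisector of `i` and `j`; the two inequalities
are added. -/
theorem inner_sub_cellCentroid_sub_nonneg (H : Admissible Q φ k α R) {P : Positions N d}
    (hM : ∀ i, 0 < cellMass Q φ k α R P i) (i j : Fin N) :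
    0 ≤ inner ℝ (P i - P j) (cellCentroid Q φ k α R P i - cellCentroid Q φ k α R P j) := by
  have h1 := inner_cellCentroid_sub_nonneg H (hM i) j
  have h2 := inner_cellCentroid_sub_nonneg H (hM j) i
  rw [← neg_sub (P i) (P j), inner_neg_left] at h2
  rw [inner_sub_right]
  linarith

/-- A trajectory that is well-behaved on an open time interval is a configuration at its end. -/
theorem IsTrajectory.mem_configurations_of_Ioo (H : Admissible Q φ k α R) (hkprop : 0 < kprop)
    {P : ℝ → Positions N d} (hP : IsTrajectory Q φ k α R kprop P)
    (h0 : P 0 ∈ configurations N Q) {T : ℝ} (hT : 0 ≤ T)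
    (hM : ∀ t ∈ Set.Ioo 0 T, ∀ i, 0 < cellMass Q φ k α R (P t) i) :
    P T ∈ configurations N Q := by
  have hsub : Set.Icc 0 T ⊆ Set.Ici 0 := Set.Icc_subset_Ici_self
  constructor
  · intro i
    by_contra hi
    obtain ⟨f, u, hu, hu'⟩ := geometric_hahn_banach_closed_point H.convex H.isCompact.isClosed hi
    -- The slack `u - f (P t i)` shrinks at most at rate `kprop`, because the centroid satisfies `f
    -- ≤ u`.
    have key := exp_mul_le_of_neg_mul_le_deriv (h := fun t => u - f (P t i)) (K := kprop) hT
      (continuousOn_const.sub (f.continuous.comp_continuousOn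
        ((hP.continuousOn_apply i).mono hsub)))
      (fun t ht => (f.hasFDerivAt.comp_hasDerivAt t (hP.hasDerivAt ht.1 i)).const_sub u)
      (fun t ht => by
        have hC := apply_cellCentroid_le H (hM t ht i) f fun q hq => (hu q hq).le
        have := mul_nonneg hkprop.le (sub_nonneg.2 hC)
        simp only [control, map_neg, map_smul, map_sub, smul_eq_mul]
        linarith)
    have h1 := hu _ (h0.1 i)
    have h2 := mul_pos (Real.exp_pos (kprop * T)) (sub_pos.2 hu')
    linarith
  · intro i j hij hPij
    have key := exp_mul_le_of_neg_mul_le_deriv (h := fun t => ‖P t i - P t j‖ ^ 2)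
      (K := 2 * kprop) hT
      ((((hP.continuousOn_apply i).sub (hP.continuousOn_apply j)).norm.pow 2).mono hsub)
      (fun t ht => (hP.hasDerivWithinAt_sq_norm_sub ht.1.le i j).hasDerivAt (Ici_mem_nhds ht.1))
      (fun t ht => by
        have := mul_nonneg hkprop.le (inner_sub_cellCentroid_sub_nonneg H (hM t ht) i j)
        linarith)
    simp only [hPij, sub_self, norm_zero, ne_eq, OfNat.ofNat_ne_zero, not_false_eq_true, zero_pow,
      mul_zero] at key
    have := h0.2 i j hij
    have : 0 < ‖P 0 i - P 0 j‖ := norm_pos_iff.2 (sub_ne_zero.2 this)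
    exact key.not_gt (by positivity)

/-- The set of configurations is invariant under the closed loop. -/
theorem IsTrajectory.mem_configurations (H : Admissible Q φ k α R) (hkprop : 0 < kprop)
    (hmass : ∀ P ∈ configurations N Q, ∀ i, 0 < cellMass Q φ k α R P i)
    {P : ℝ → Positions N d} (hP : IsTrajectory Q φ k α R kprop P)
    (h0 : P 0 ∈ configurations N Q) {t : ℝ} (ht : 0 ≤ t) : P t ∈ configurations N Q := by
  by_contra hbad
  set B := {s : ℝ | 0 ≤ s ∧ P s ∉ configurations N Q} with hB
  have hBne : B.Nonempty := ⟨t, ht, hbad⟩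
  have hBbdd : BddBelow B := ⟨0, fun s hs => hs.1⟩
  have hτ0 : 0 ≤ sInf B := le_csInf hBne fun s hs => hs.1
  have hbefore : ∀ s ∈ Set.Ico 0 (sInf B), P s ∈ configurations N Q := fun s hs => by
    by_contra h
    exact (csInf_le hBbdd ⟨hs.1, h⟩).not_gt hs.2
  have hτ : P (sInf B) ∈ configurations N Q :=
    hP.mem_configurations_of_Ioo H hkprop h0 hτ0 fun s hs =>
      hmass _ (hbefore s ⟨hs.1.le, hs.2⟩)
  -- At the infimum of the bad times the positions still form a configuration, and positivity of the
  -- masses is open around it. The masses thus stay positive slightly longer, which excludes bad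
  -- times just after the infimum.
  have hev : ∀ᶠ P' in 𝓝 (P (sInf B)), ∀ i, 0 < cellMass Q φ k α R P' i :=
    eventually_all.2 fun i => continuousAt_const.eventually_lt
      (continuousAt_cellMass H hτ.2 i) (hmass _ hτ i)
  have hev' : ∀ᶠ s in 𝓝[Set.Ici 0] (sInf B), ∀ i, 0 < cellMass Q φ k α R (P s) i :=
    (hP.continuousOn (sInf B) hτ0).eventually hev
  obtain ⟨ε, hε, hball⟩ := Metric.mem_nhdsWithin_iff.1 hev'
  obtain ⟨s, hs, hsε⟩ := exists_lt_of_csInf_lt hBne (lt_add_of_pos_right (sInf B) hε)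
  refine hs.2 (hP.mem_configurations_of_Ioo H hkprop h0 hs.1 fun r hr => ?_)
  rcases lt_or_ge r (sInf B) with h | h
  · exact hmass _ (hbefore r ⟨hr.1.le, h⟩)
  · refine hball ⟨?_, hr.1.le⟩
    rw [Metric.mem_ball, Real.dist_eq, abs_of_nonneg (sub_nonneg.2 h)]
    linarith [hr.2]

end Invariance

/-! ### Repulsion inside an isolated group -/

section Cluster

variable {N d : ℕ} {Q : Set (Space d)} {φ : Space d → ℝ} {k α R : ℝ}

/-- The positions of `a` and of the robots outside `S` extend to `N` distinct points of the infinite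
set `Q`. In that configuration the cell of the robot at `P a` has positive mass, and it lies inside
the group's cell. Members of `S` may coincide in `P`. -/
theorem measure_limitedCell_pos (H : Admissible Q φ k α R) (hinf : Q.Infinite)
    (hmass : ∀ P ∈ configurations N Q, ∀ i, 0 < cellMass Q φ k α R P i)
    {S : Finset (Fin N)} {a : Fin N} (ha : a ∈ S) {P : Positions N d} (hPQ : ∀ i, P i ∈ Q) :
    0 < densityMeasure Q φ (limitedCell R S a P) := by
  classical
  have hN : N ≠ 0 := by rintro rfl; exact a.elim0
  set T : Finset (Space d) := insert (P a) (Sᶜ.image P) with hT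
  have hTQ : (T : Set (Space d)) ⊆ Q := fun x hx => by
    rw [hT, Finset.coe_insert, Finset.coe_image] at hx
    rcases hx with rfl | ⟨i, -, rfl⟩ <;> exact hPQ _
  have hcard : (T : Set (Space d)).ncard ≤ N := by
    rw [Set.ncard_coe_finset]
    have h1 : (Sᶜ.image P).card ≤ Sᶜ.card := Finset.card_image_le
    have h2 := Finset.card_insert_le (P a) (Sᶜ.image P)
    have h3 := S.card_compl_add_card
    have h4 : 0 < S.card := Finset.card_pos.2 ⟨a, ha⟩
    rw [Fintype.card_fin] at h3
    rw [hT]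
    omega
  obtain ⟨s, hTs, hsQ, hsN⟩ := hinf.exists_superset_ncard_eq hTQ T.finite_toSet hcard
  have hsfin : s.Finite := Set.finite_of_ncard_ne_zero (hsN ▸ hN)
  have := hsfin.to_subtype
  let e : s ≃ Fin N := Finite.equivFinOfCardEq hsN
  have hcfg : (fun i => (e.symm i : Space d)) ∈ configurations N Q :=
    ⟨fun i => hsQ (e.symm i).2, fun i j hij h => hij (e.symm.injective (Subtype.ext h))⟩
  have haT : P a ∈ s := hTs (by simp [hT])
  set b := e ⟨P a, haT⟩ with hb
  have hpos := hmass _ hcfg b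
  rw [cellMass_eq H] at hpos
  have hsub : limitedCell R {b} b (fun i => (e.symm i : Space d)) ⊆ limitedCell R S a P := by
    intro q hq
    rw [mem_limitedCell_singleton] at hq
    simp only [hb, Equiv.symm_apply_apply] at hq
    rw [mem_limitedCell ha]
    refine ⟨hq.1, fun l hl => ?_⟩
    have hlT : P l ∈ s := hTs (by
      rw [hT, Finset.coe_insert, Finset.coe_image]
      exact Or.inr ⟨l, by simpa using hl, rfl⟩)
    simpa using hq.2 (e ⟨P l, hlT⟩)
  refine lt_of_lt_of_le (pos_iff_ne_zero.2 fun h0 => ?_) (measure_mono hsub)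
  rw [Measure.restrict_zero_set h0, integral_zero_measure] at hpos
  exact hpos.false

/-- The moment of a limited cell with respect to the hyperplane through `c` with normal `e`. -/
def hyperplaneMoment (Q : Set (Space d)) (φ : Space d → ℝ) (R : ℝ) (S : Finset (Fin N))
    (a : Fin N) (P : Positions N d) (c e : Space d) : ℝ :=
  ∫ q in limitedCell R S a P, |inner ℝ (q - c) e| ∂densityMeasure Q φ

theorem hyperplaneMoment_pos (H : Admissible Q φ k α R) {S : Finset (Fin N)} {a : Fin N}
    {P : Positions N d} (hpos : 0 < densityMeasure Q φ (limitedCell R S a P)) (c : Space d)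
    {e : Space d} (he : e ≠ 0) : 0 < hyperplaneMoment Q φ R S a P c e := by
  have hint : Integrable (fun q => |inner ℝ (q - c) e|) (densityMeasure Q φ) :=
    H.integrable (by fun_prop)
  refine lt_of_le_of_ne (integral_nonneg fun q => abs_nonneg _) fun h0 => hpos.ne' ?_
  have hzero := (setIntegral_eq_zero_iff_of_nonneg_ae
    (Eventually.of_forall fun q => abs_nonneg _) hint.integrableOn).1 h0.symm
  have hne : ∀ᵐ q ∂densityMeasure Q φ, inner ℝ (q - c) e ≠ 0 := by
    rw [ae_iff]
    simpa using measure_hyperplane_eq_zero densityMeasure_absolutelyContinuous c he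
  rw [← Measure.restrict_eq_zero, ← ae_eq_bot, ← eventually_false_iff_eq_bot]
  filter_upwards [hzero, ae_restrict_of_ae hne] with q h1 h2
  exact h2 (abs_eq_zero.1 h1)

/-- The moment is positive and continuous on a compact set of data. Only the distances from `a` to
robots outside `S` are kept away from zero, so the bound survives the collapse of the group. -/
theorem exists_le_hyperplaneMoment (H : Admissible Q φ k α R) (hinf : Q.Infinite)
    (hmass : ∀ P ∈ configurations N Q, ∀ i, 0 < cellMass Q φ k α R P i)
    {S : Finset (Fin N)} {a : Fin N} (ha : a ∈ S) {r : ℝ} (hr : 0 < r) :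
    ∃ c₀, 0 < c₀ ∧ ∀ P : Positions N d, (∀ i, P i ∈ Q) → (∀ l ∉ S, r ≤ ‖P a - P l‖) →
      ∀ c ∈ Q, ∀ e : Space d, ‖e‖ = 1 → c₀ ≤ hyperplaneMoment Q φ R S a P c e := by
  have hfin := H.isFiniteMeasure
  have hK : IsCompact ((Set.univ.pi fun _ : Fin N => Q) ∩ {P | ∀ l ∉ S, r ≤ ‖P a - P l‖}) := by
    refine (isCompact_univ_pi fun _ => H.isCompact).inter_right ?_
    simp only [Set.ofPred_forall]
    refine isClosed_iInter fun l => isClosed_iInter fun _ => isClosed_le continuous_const ?_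
    exact ((continuous_apply a).sub (continuous_apply l)).norm
  set K := ((Set.univ.pi fun _ : Fin N => Q) ∩ {P | ∀ l ∉ S, r ≤ ‖P a - P l‖}) ×ˢ
    (Q ×ˢ Metric.sphere (0 : Space d) 1) with hKdef
  have hcont : ContinuousOn (fun z : Positions N d × Space d × Space d =>
      hyperplaneMoment Q φ R S a z.1 z.2.1 z.2.2) K := fun z hz => by
    refine ContinuousAt.continuousWithinAt ?_
    refine continuousAt_setIntegral_limitedCell (Y := Space d × Space d) H.isCompact H.ae_mem
      densityMeasure_absolutelyContinuous H.R_pos.ne' (fun l hl hal => ?_)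
      (h := fun z q => |inner ℝ (q - z.2.1) z.2.2|) (by fun_prop) z.2
    have := hz.1.2 l hl
    rw [hal, sub_self, norm_zero] at this
    exact this.not_gt hr
  obtain ⟨c₀, hc₀, h⟩ := (hK.prod (H.isCompact.prod (isCompact_sphere (0 : Space d) 1))
    ).exists_forall_le' hcont (a := 0) fun z hz =>
      hyperplaneMoment_pos H (measure_limitedCell_pos H hinf hmass ha
        fun i => hz.1.1 i (Set.mem_univ i)) _ (ne_zero_of_mem_unit_sphere ⟨z.2.2, hz.2.2⟩)
  exact ⟨c₀, hc₀, fun P hPQ hPr c hc e he =>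
    h (P, c, e) ⟨⟨fun i _ => hPQ i, hPr⟩, hc, by simpa using he⟩⟩

/-- Each point of the group's cell lies in the cell of the member of `S` nearest to it. -/
theorem setIntegral_limitedCell_le_sum (H : Admissible Q φ k α R) {S : Finset (Fin N)} {a : Fin N}
    (ha : a ∈ S) (P : Positions N d) {g : Space d → ℝ} (hg : Continuous g) (hg0 : ∀ q, 0 ≤ g q) :
    ∫ q in limitedCell R S a P, g q ∂densityMeasure Q φ ≤
      ∑ i ∈ S, ∫ q in limitedCell R {i} i P, g q ∂densityMeasure Q φ := by
  simp_rw [← integral_indicator (measurableSet_limitedCell _ _ _ _)]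
  rw [← integral_finsetSum _ fun i _ =>
    (H.integrable hg).indicator (measurableSet_limitedCell _ _ _ _)]
  refine integral_mono ((H.integrable hg).indicator (measurableSet_limitedCell _ _ _ _))
    (integrable_finsetSum _ fun i _ =>
      (H.integrable hg).indicator (measurableSet_limitedCell _ _ _ _)) fun q => ?_
  have hnn : ∀ i ∈ S, 0 ≤ (limitedCell R {i} i P).indicator g q := fun i _ =>
    Set.indicator_nonneg (fun q _ => hg0 q) q
  by_cases hq : q ∈ limitedCell R S a P
  · obtain ⟨i, hi, hmin⟩ := S.exists_min_image (fun i => ‖q - P i‖) ⟨a, ha⟩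
    rw [mem_limitedCell ha] at hq
    have hqi : q ∈ limitedCell R {i} i P := by
      refine mem_limitedCell_singleton.2 ⟨(hmin a ha).trans hq.1, fun l => ?_⟩
      by_cases hl : l ∈ S
      · exact hmin l hl
      · exact (hmin a ha).trans (hq.2 l hl)
    refine (Set.indicator_le_self' (fun _ _ => hg0 _) q).trans ?_
    rw [← Set.indicator_of_mem hqi g]
    exact Finset.single_le_sum hnn hi
  · rw [Set.indicator_of_notMem hq]
    exact Finset.sum_nonneg hnn

theorem cellMass_le (H : Admissible Q φ k α R) (P : Positions N d) (i : Fin N) :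
    cellMass Q φ k α R P i ≤ k * (densityMeasure Q φ).real Set.univ := by
  have := H.isFiniteMeasure
  have hle : ∀ q, sensing k α (P i) q ≤ k := fun q => by
    have h1 : Real.exp (-α * ‖P i - q‖ ^ 2) ≤ 1 := Real.exp_le_one_iff.2 (by
      have := mul_nonneg H.α_pos.le (sq_nonneg ‖P i - q‖)
      linarith)
    exact mul_le_of_le_one_right H.k_pos.le h1
  rw [cellMass_eq H]
  calc _ ≤ ∫ q, sensing k α (P i) q ∂densityMeasure Q φ :=
        setIntegral_le_integral (H.integrable (by fun_prop))
          (Eventually.of_forall fun q => (sensing_pos H.k_pos _ _ _).le)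
    _ ≤ ∫ _, k ∂densityMeasure Q φ :=
        integral_mono (H.integrable (by fun_prop)) (integrable_const _) hle
    _ = _ := by simp [mul_comm]

/-- The centroids of the cells of a group of robots that is isolated from the others drive the
robots of the group apart. -/
theorem exists_le_sum_inner_cellCentroid (H : Admissible Q φ k α R) (hinf : Q.Infinite)
    (hmass : ∀ P ∈ configurations N Q, ∀ i, 0 < cellMass Q φ k α R P i)
    {S : Finset (Fin N)} {a : Fin N} (ha : a ∈ S) {r : ℝ} (hr : 0 < r) :
    ∃ c, 0 < c ∧ ∀ P ∈ configurations N Q, (∀ l ∉ S, r ≤ ‖P a - P l‖) →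
      ∀ x ∈ S, ∀ y ∈ S, c * ‖P x - P y‖ ≤ ∑ i ∈ S, ∑ j ∈ S, inner ℝ (P i - P j)
        (cellCentroid Q φ k α R P i - cellCentroid Q φ k α R P j) := by
  have hfin := H.isFiniteMeasure
  obtain ⟨c₀, hc₀, hJ⟩ := exists_le_hyperplaneMoment H hinf hmass ha hr
  set V := k * (densityMeasure Q φ).real Set.univ + 1 with hV
  have hV0 : 0 < V := by have := H.k_pos; positivity
  set κ := k * Real.exp (-α * R ^ 2) with hκ
  have hκ0 : 0 < κ := mul_pos H.k_pos (Real.exp_pos _)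
  refine ⟨2 * (V⁻¹ * (κ / 2) * (2 * c₀)), by positivity, fun P hP hPr x hx y hy => ?_⟩
  set ν := densityMeasure Q φ with hν
  set side : Fin N → Fin N → ℝ := fun i j =>
    inner ℝ (P i - P j) (cellCentroid Q φ k α R P i) - (‖P i‖ ^ 2 - ‖P j‖ ^ 2) / 2 with hside
  set w : Fin N → Fin N → Space d → ℝ := fun i j q => ‖q - P j‖ ^ 2 - ‖q - P i‖ ^ 2 with hw
  have hwc : ∀ i j, Continuous (w i j) := fun i j => by simp only [hw]; fun_prop
  have hw0 : ∀ i j, ∀ q ∈ limitedCell R {i} i P, 0 ≤ w i j q := fun i j q hq => by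
    have h1 := (mem_limitedCell_singleton.1 hq).2 j
    exact sub_nonneg.2 (by gcongr)
  -- Each pair contributes the offsets of both centroids from the common bisector; exchanging the
  -- indices identifies the two sums.
  have hsplit : ∑ i ∈ S, ∑ j ∈ S, inner ℝ (P i - P j)
      (cellCentroid Q φ k α R P i - cellCentroid Q φ k α R P j) =
      2 * ∑ i ∈ S, ∑ j ∈ S, side i j := by
    rw [two_mul]
    nth_rewrite 2 [Finset.sum_comm]
    rw [← Finset.sum_add_distrib]
    refine Finset.sum_congr rfl fun i _ => ?_
    rw [← Finset.sum_add_distrib]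
    refine Finset.sum_congr rfl fun j _ => ?_
    simp only [hside]
    rw [← neg_sub (P i) (P j), inner_neg_left, inner_sub_right]
    ring
  have hsens : ∀ i, ∀ q ∈ limitedCell R {i} i P, κ ≤ sensing k α (P i) q := fun i q hq => by
    have h1 := (mem_limitedCell_singleton.1 hq).1
    rw [norm_sub_rev] at h1
    have h2 : ‖P i - q‖ ^ 2 ≤ R ^ 2 := by gcongr
    refine mul_le_mul_of_nonneg_left (Real.exp_le_exp.2 ?_) H.k_pos.le
    nlinarith [H.α_pos]
  have hside_ge : ∀ i j, V⁻¹ * (κ / 2) * ∫ q in limitedCell R {i} i P, w i j q ∂ν ≤ side i j := by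
    intro i j
    have hM := hmass P hP i
    simp only [hside]
    rw [inner_cellCentroid_sub H hM, mul_assoc]
    refine mul_le_mul ?_ ?_ ?_ (inv_nonneg.2 hM.le)
    · exact inv_anti₀ hM ((cellMass_le H P i).trans (le_add_of_nonneg_right zero_le_one))
    · rw [← integral_const_mul]
      refine setIntegral_mono_on (H.integrable (by fun_prop)).integrableOn
        (H.integrable (by fun_prop)).integrableOn (measurableSet_limitedCell _ _ _ _)
        fun q hq => ?_
      have := mul_le_mul_of_nonneg_right (hsens i q hq)
        (div_nonneg (hw0 i j q hq) zero_le_two)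
      simp only [hw] at this ⊢
      linarith
    · exact mul_nonneg (by positivity)
        (setIntegral_nonneg (measurableSet_limitedCell _ _ _ _) (hw0 i j))
  -- On the cell of `i` all `w i j` are nonnegative and `w x y = w i y - w i x`, so `|w x y|` is at
  -- most `∑ j ∈ S, w i j`.
  have hrow : ∀ i, V⁻¹ * (κ / 2) * ∫ q in limitedCell R {i} i P, |w x y q| ∂ν ≤
      ∑ j ∈ S, side i j := by
    intro i
    refine le_trans ?_ (Finset.sum_le_sum fun j _ => hside_ge i j)
    rw [← Finset.mul_sum]
    refine mul_le_mul_of_nonneg_left ?_ (by positivity)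
    rw [← integral_finsetSum _ fun j _ => (H.integrable (hwc i j)).integrableOn]
    refine setIntegral_mono_on (H.integrable (hwc x y).abs).integrableOn
      (H.integrable (continuous_finsetSum _ fun j _ => hwc i j)).integrableOn
      (measurableSet_limitedCell _ _ _ _) fun q hq => ?_
    have h1 : ∀ j ∈ S, w i j q ≤ ∑ j ∈ S, w i j q := fun j hj =>
      Finset.single_le_sum (fun j _ => hw0 i j q hq) hj
    have h2 : w x y q = w i y q - w i x q := by simp only [hw]; ring
    have hx1 := h1 x hx
    have hy1 := h1 y hy
    have hx0 := hw0 i x q hq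
    have hy0 := hw0 i y q hq
    rw [h2, abs_le]
    constructor <;> linarith
  have htotal : V⁻¹ * (κ / 2) * ∫ q in limitedCell R S a P, |w x y q| ∂ν ≤
      ∑ i ∈ S, ∑ j ∈ S, side i j := by
    refine le_trans ?_ (Finset.sum_le_sum fun i _ => hrow i)
    rw [← Finset.mul_sum]
    exact mul_le_mul_of_nonneg_left (setIntegral_limitedCell_le_sum H ha P (hwc x y).abs
      fun q => abs_nonneg _) (by positivity)
  -- `w x y q` is `2 ‖P x - P y‖` times the signed distance from `q` to the bisector, which passes
  -- through the midpoint. This makes the bound linear in the distance.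
  have hmoment : 2 * c₀ * ‖P x - P y‖ ≤ ∫ q in limitedCell R S a P, |w x y q| ∂ν := by
    rcases eq_or_ne (P x) (P y) with hxy | hxy
    · rw [hxy, sub_self, norm_zero, mul_zero]
      exact integral_nonneg fun q => abs_nonneg _
    have hn : 0 < ‖P x - P y‖ := norm_pos_iff.2 (sub_ne_zero.2 hxy)
    have hmid : midpoint ℝ (P x) (P y) ∈ Q :=
      H.convex.midpoint_mem (hP.1 x) (hP.1 y)
    have h1 := hJ P hP.1 hPr _ hmid (‖P x - P y‖⁻¹ • (P x - P y)) (by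
      rw [norm_smul, norm_inv, norm_norm, inv_mul_cancel₀ hn.ne'])
    have h2 : ∀ q, |w x y q| = 2 * ‖P x - P y‖ *
        |inner ℝ (q - midpoint ℝ (P x) (P y)) (‖P x - P y‖⁻¹ • (P x - P y))| := by
      intro q
      have h3 : w x y q = 2 * inner ℝ (q - midpoint ℝ (P x) (P y)) (P x - P y) := by
        simp only [hw, midpoint_eq_smul_add, norm_sub_sq_real, inner_sub_left, inner_sub_right,
          real_inner_smul_left, inner_add_left, real_inner_self_eq_norm_sq,
          real_inner_comm (P x) (P y), invOf_eq_inv]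
        ring
      rw [real_inner_smul_right, abs_mul, abs_of_pos (inv_pos.2 hn), h3, abs_mul,
        abs_of_pos (zero_lt_two' ℝ)]
      field_simp
    simp_rw [h2]
    rw [integral_const_mul]
    have := mul_le_mul_of_nonneg_left h1 (mul_nonneg zero_le_two hn.le)
    rw [hyperplaneMoment] at this
    linarith
  rw [hsplit]
  have := mul_le_mul_of_nonneg_left hmoment (by positivity : 0 ≤ V⁻¹ * (κ / 2))
  linarith

end Cluster

/-! ### Uniform separation of the robots along a trajectory -/

section Separation

variable {N d : ℕ} {Q : Set (Space d)} {φ : Space d → ℝ} {k α R kprop : ℝ}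

/-- The sum of the squared distances between the robots of a group. -/
def spread (S : Finset (Fin N)) (P : Positions N d) : ℝ := ∑ i ∈ S, ∑ j ∈ S, ‖P i - P j‖ ^ 2

theorem sq_norm_sub_le_spread {S : Finset (Fin N)} (P : Positions N d) {i j : Fin N} (hi : i ∈ S)
    (hj : j ∈ S) : ‖P i - P j‖ ^ 2 ≤ spread S P :=
  (Finset.single_le_sum (f := fun j => ‖P i - P j‖ ^ 2) (fun _ _ => sq_nonneg _) hj).trans
    (Finset.single_le_sum (f := fun i => ∑ j ∈ S, ‖P i - P j‖ ^ 2)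
      (fun _ _ => Finset.sum_nonneg fun _ _ => sq_nonneg _) hi)

theorem spread_le {S : Finset (Fin N)} (P : Positions N d) {D : ℝ}
    (hD : ∀ i ∈ S, ∀ j ∈ S, ‖P i - P j‖ ^ 2 ≤ D) : spread S P ≤ (S.card : ℝ) ^ 2 * D := by
  calc spread S P ≤ ∑ i ∈ S, ∑ j ∈ S, D :=
        Finset.sum_le_sum fun i hi => Finset.sum_le_sum fun j hj => hD i hi j hj
    _ = (S.card : ℝ) ^ 2 * D := by simp; ring

theorem spread_pos {S : Finset (Fin N)} (hS : 1 < S.card) {P : Positions N d}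
    (hP : ∀ i j, i ≠ j → P i ≠ P j) : 0 < spread S P := by
  obtain ⟨i, hi, j, hj, hij⟩ := Finset.one_lt_card.1 hS
  have : 0 < ‖P i - P j‖ := norm_pos_iff.2 (sub_ne_zero.2 (hP i j hij))
  exact lt_of_lt_of_le (by positivity) (sq_norm_sub_le_spread P hi hj)

theorem IsTrajectory.hasDerivWithinAt_spread {P : ℝ → Positions N d}
    (hP : IsTrajectory Q φ k α R kprop P) (S : Finset (Fin N)) {t : ℝ} (ht : 0 ≤ t) :
    HasDerivWithinAt (fun s => spread S (P s)) (2 * kprop * (∑ i ∈ S, ∑ j ∈ S,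
      inner ℝ (P t i - P t j)
        (cellCentroid Q φ k α R (P t) i - cellCentroid Q φ k α R (P t) j) - spread S (P t)))
      (Set.Ici 0) t := by
  refine (HasDerivWithinAt.fun_sum fun i _ => HasDerivWithinAt.fun_sum fun j _ =>
    hP.hasDerivWithinAt_sq_norm_sub ht i j).congr_deriv ?_
  simp only [spread, ← Finset.sum_sub_distrib, Finset.mul_sum]

/-- A barrier argument: whenever `h` is at the level `m` it is strictly increasing, so it cannot
cross downwards. -/
theorem le_of_deriv_pos_of_eq {h h' : ℝ → ℝ} {m : ℝ} (h0 : m ≤ h 0)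
    (hd : ∀ t, 0 ≤ t → HasDerivWithinAt h (h' t) (Set.Ici 0) t)
    (hpos : ∀ t, 0 ≤ t → h t = m → 0 < h' t) {t : ℝ} (ht : 0 ≤ t) : m ≤ h t := by
  have := image_le_of_deriv_right_lt_deriv_boundary' (f := fun t => -h t) (f' := fun t => -h' t)
    (a := 0) (b := t) (B := fun _ => -m) (B' := fun _ => 0)
    (fun s hs => ((hd s hs.1).continuousWithinAt.neg).mono Set.Icc_subset_Ici_self)
    (fun s hs => ((hd s hs.1).mono (Set.Ici_subset_Ici.2 hs.1)).neg) (neg_le_neg h0)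
    continuousOn_const (fun s _ => hasDerivWithinAt_const _ _ _)
    (fun s hs hs' => neg_neg_of_pos (hpos s hs.1 (neg_injective hs')))
  exact neg_le_neg_iff.1 (this (Set.right_mem_Icc.2 ht))

/-- A tight group whose extensions by any other robot are spread out is isolated. -/
theorem le_norm_sub_of_spread {S : Finset (Fin N)} {a : Fin N} (ha : a ∈ S) {P : Positions N d}
    {ρ δ : ℝ} (hρ : 0 < ρ) (hρδ : (2 * ((S.card : ℝ) + 1)) ^ 2 * ρ ^ 2 < δ)
    (hS : spread S P ≤ ρ ^ 2) {l : Fin N} (hl : l ∉ S) (hδ : δ ≤ spread (insert l S) P) :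
    ρ ≤ ‖P a - P l‖ := by
  by_contra! hlt
  have h1 : ∀ i ∈ S, ‖P i - P a‖ ≤ ρ := fun i hi =>
    le_of_sq_le_sq ((sq_norm_sub_le_spread P hi ha).trans hS) hρ.le
  have h2 : ∀ i ∈ insert l S, ‖P i - P a‖ ≤ ρ := fun i hi => by
    rcases Finset.mem_insert.1 hi with rfl | hi
    · rw [norm_sub_rev]; exact hlt.le
    · exact h1 i hi
  have h3 : spread (insert l S) P ≤ ((insert l S).card : ℝ) ^ 2 * (2 * ρ) ^ 2 := by
    refine spread_le P fun i hi j hj => ?_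
    have h4 := norm_sub_le_norm_sub_add_norm_sub (P i) (P a) (P j)
    have h5 := h2 j hj
    rw [norm_sub_rev] at h5
    have h6 := h2 i hi
    have : ‖P i - P j‖ ≤ 2 * ρ := by linarith
    gcongr
  rw [Finset.card_insert_of_notMem hl] at h3
  push_cast at h3
  nlinarith

/-- When the spread of `S` is small, the bounds for the enlarged groups keep all other robots away
from `a`. The repulsion, linear in the diameter, then exceeds the quadratic contraction. -/
theorem IsTrajectory.exists_le_spread_of_insert (H : Admissible Q φ k α R) (hkprop : 0 < kprop)
    (hmass : ∀ P ∈ configurations N Q, ∀ i, 0 < cellMass Q φ k α R P i)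
    {P : ℝ → Positions N d} (hP : IsTrajectory Q φ k α R kprop P)
    (h0 : P 0 ∈ configurations N Q) {S : Finset (Fin N)} (hS : 1 < S.card)
    (hins : ∃ δ, 0 < δ ∧ ∀ l ∉ S, ∀ t, 0 ≤ t → δ ≤ spread (insert l S) (P t)) :
    ∃ δ, 0 < δ ∧ ∀ t, 0 ≤ t → δ ≤ spread S (P t) := by
  have hcfg : ∀ t, 0 ≤ t → P t ∈ configurations N Q := fun t ht =>
    hP.mem_configurations H hkprop hmass h0 ht
  obtain ⟨a, ha, b, hb, hab⟩ := Finset.one_lt_card.1 hS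
  have hinf : Q.Infinite := (H.convex.isPreconnected).infinite_of_nontrivial
    ⟨_, h0.1 a, _, h0.1 b, h0.2 a b hab⟩
  obtain ⟨δ, hδ, hins⟩ := hins
  set n : ℝ := (S.card : ℝ) with hn
  have hn0 : 0 < n := Nat.cast_pos.2 (by omega)
  obtain ⟨ρ, hρ, hρδ⟩ : ∃ ρ : ℝ, 0 < ρ ∧ (2 * (n + 1)) ^ 2 * ρ ^ 2 < δ := by
    refine ⟨√(δ / 2) / (2 * (n + 1)), by positivity, ?_⟩
    rw [div_pow, Real.sq_sqrt (by positivity), mul_div_cancel₀ _ (by positivity)]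
    linarith
  obtain ⟨c, hc, hsum⟩ := exists_le_sum_inner_cellCentroid H hinf hmass ha hρ
  -- The three bounds serve, in order, for the isolation of the group, for the initial time, and for
  -- `n² D < c` when the spread equals `m`.
  set m : ℝ := min (min (ρ ^ 2) (spread S (P 0))) (c ^ 2 / (2 * n ^ 4)) with hm
  have hm0 : 0 < m := lt_min (lt_min (by positivity) (spread_pos hS h0.2)) (by positivity)
  have hmρ : m ≤ ρ ^ 2 := (min_le_left _ _).trans (min_le_left _ _)
  have hmc : m * n ^ 4 < c ^ 2 := by
    have h1 : m ≤ c ^ 2 / (2 * n ^ 4) := min_le_right _ _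
    rw [le_div_iff₀ (by positivity)] at h1
    nlinarith [pow_pos hn0 4]
  refine ⟨m, hm0, fun t ht => le_of_deriv_pos_of_eq
    ((min_le_left _ _).trans (min_le_right _ _)) (fun t ht => hP.hasDerivWithinAt_spread S ht)
    (fun t ht hEq => mul_pos (by positivity) (sub_pos.2 ?_)) ht⟩
  obtain ⟨⟨x, y⟩, hxy, hmax⟩ := (S ×ˢ S).exists_max_image (fun z => ‖P t z.1 - P t z.2‖)
    ⟨(a, a), Finset.mk_mem_product ha ha⟩
  obtain ⟨hx, hy⟩ := Finset.mem_product.1 hxy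
  have hlow := hsum (P t) (hcfg t ht)
    (fun l hl => le_norm_sub_of_spread ha hρ hρδ (hEq.le.trans hmρ) hl (hins l hl t ht)) x hx y hy
  refine lt_of_lt_of_le ?_ hlow
  set D := ‖P t x - P t y‖ with hD
  have hD0 : 0 ≤ D := norm_nonneg _
  have hup : spread S (P t) ≤ n ^ 2 * D ^ 2 := spread_le (P t) fun i hi j hj => by
    have : ‖P t i - P t j‖ ≤ D := hmax (i, j) (Finset.mk_mem_product hi hj)
    gcongr
  have hDm : D ^ 2 ≤ m := (sq_norm_sub_le_spread (P t) hx hy).trans_eq hEq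
  have hDc : n ^ 2 * D < c := by
    refine lt_of_pow_lt_pow_left₀ 2 hc.le ?_
    calc (n ^ 2 * D) ^ 2 = D ^ 2 * n ^ 4 := by ring
      _ ≤ m * n ^ 4 := by gcongr
      _ < c ^ 2 := hmc
  have hDpos : 0 < D := by
    refine lt_of_le_of_ne hD0 fun h => ?_
    rw [← h, hEq] at hup
    simp only [ne_eq, OfNat.ofNat_ne_zero, not_false_eq_true, zero_pow, mul_zero] at hup
    exact hup.not_gt hm0
  nlinarith

/-- The spread of any group of robots is bounded away from zero along a trajectory. -/
theorem IsTrajectory.exists_le_spread (H : Admissible Q φ k α R) (hkprop : 0 < kprop)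
    (hmass : ∀ P ∈ configurations N Q, ∀ i, 0 < cellMass Q φ k α R P i)
    {P : ℝ → Positions N d} (hP : IsTrajectory Q φ k α R kprop P)
    (h0 : P 0 ∈ configurations N Q) (S : Finset (Fin N)) (hS : 1 < S.card) :
    ∃ δ, 0 < δ ∧ ∀ t, 0 ≤ t → δ ≤ spread S (P t) := by
  -- Downward induction on the size of `S`. For the group of all robots there is nothing to insert,
  -- so no base case is needed.
  induction hn : N - S.card using Nat.strong_induction_on generalizing S with
  | _ n ih =>
  refine hP.exists_le_spread_of_insert H hkprop hmass h0 hS ?_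
  have hex : ∀ l, ∃ δ, 0 < δ ∧ (l ∉ S → ∀ t, 0 ≤ t → δ ≤ spread (insert l S) (P t)) := by
    intro l
    by_cases hl : l ∈ S
    · exact ⟨1, one_pos, fun h => (h hl).elim⟩
    · have hcard := Finset.card_insert_of_notMem hl
      have hle := (insert l S).card_le_univ
      rw [Fintype.card_fin] at hle
      obtain ⟨δ, hδ, h⟩ := ih (N - (insert l S).card) (by omega) (insert l S) (by omega) rfl
      exact ⟨δ, hδ, fun _ => h⟩
  choose δ hδ hle using hex
  obtain ⟨i, -⟩ : S.Nonempty := Finset.card_pos.1 (by omega)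
  have : Nonempty (Fin N) := ⟨i⟩
  obtain ⟨l₀, hl₀⟩ := Finite.exists_min δ
  exact ⟨δ l₀, hδ l₀, fun l hl t ht => (hl₀ l).trans (hle l hl t ht)⟩

/-- The robots stay uniformly apart along a trajectory. -/
theorem IsTrajectory.exists_le_norm_sub (H : Admissible Q φ k α R) (hkprop : 0 < kprop)
    (hmass : ∀ P ∈ configurations N Q, ∀ i, 0 < cellMass Q φ k α R P i)
    {P : ℝ → Positions N d} (hP : IsTrajectory Q φ k α R kprop P)
    (h0 : P 0 ∈ configurations N Q) :
    ∃ η, 0 < η ∧ ∀ t, 0 ≤ t → ∀ i j, i ≠ j → η ≤ ‖P t i - P t j‖ := by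
  have hex : ∀ z : Fin N × Fin N, ∃ η, 0 < η ∧
      (z.1 ≠ z.2 → ∀ t, 0 ≤ t → η ≤ ‖P t z.1 - P t z.2‖) := by
    rintro ⟨i, j⟩
    by_cases hij : i = j
    · exact ⟨1, one_pos, fun h => (h hij).elim⟩
    · obtain ⟨δ, hδ, h⟩ := hP.exists_le_spread H hkprop hmass h0 {i, j}
        (by rw [Finset.card_pair hij]; norm_num)
      -- The spread of a pair counts its squared distance twice.
      refine ⟨√(δ / 2), by positivity, fun _ t ht => Real.sqrt_le_iff.2 ⟨norm_nonneg _, ?_⟩⟩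
      have h1 := h t ht
      rw [spread, Finset.sum_pair hij, Finset.sum_pair hij, Finset.sum_pair hij,
        norm_sub_rev (P t j) (P t i)] at h1
      simp only [sub_self, norm_zero, ne_eq, OfNat.ofNat_ne_zero, not_false_eq_true, zero_pow]
        at h1
      simp only
      linarith
  choose η hη hle using hex
  rcases isEmpty_or_nonempty (Fin N) with hN | hN
  · exact ⟨1, one_pos, fun _ _ i => (hN.false i).elim⟩
  · obtain ⟨z₀, hz₀⟩ := Finite.exists_min η
    exact ⟨η z₀, hη z₀, fun t ht i j hij => (hz₀ (i, j)).trans (hle (i, j) hij t ht)⟩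

end Separation

/-! ### LaSalle-type convergence to the critical points -/

section Convergence

variable {N d : ℕ} {Q : Set (Space d)} {φ : Space d → ℝ} {k α R kprop : ℝ}

/-- The weighted squared deviation of the robots from the centroids of their cells. -/
def deviation (Q : Set (Space d)) (φ : Space d → ℝ) (k α R : ℝ) (P : Positions N d) : ℝ :=
  ∑ i, cellMass Q φ k α R P i * ‖P i - cellCentroid Q φ k α R P i‖ ^ 2

theorem continuousAt_deviation (H : Admissible Q φ k α R) {P : Positions N d}
    (hP : ∀ i j, i ≠ j → P i ≠ P j) (hM : ∀ i, 0 < cellMass Q φ k α R P i) :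
    ContinuousAt (deviation Q φ k α R) P :=
  tendsto_finsetSum _ fun i _ => (continuousAt_cellMass H hP i).mul
    ((((continuous_apply i).continuousAt).sub (continuousAt_cellCentroid H hP (hM i))).norm.pow 2)

theorem deviation_nonneg {P : Positions N d} (hM : ∀ i, 0 < cellMass Q φ k α R P i) :
    0 ≤ deviation Q φ k α R P :=
  Finset.sum_nonneg fun i _ => mul_nonneg (hM i).le (sq_nonneg _)

theorem deviation_pos {P : Positions N d} (hM : ∀ i, 0 < cellMass Q φ k α R P i) {i : Fin N}
    (hi : P i ≠ cellCentroid Q φ k α R P i) : 0 < deviation Q φ k α R P := by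
  refine Finset.sum_pos' (fun i _ => mul_nonneg (hM i).le (sq_nonneg _)) ⟨i, Finset.mem_univ i, ?_⟩
  have : 0 < ‖P i - cellCentroid Q φ k α R P i‖ := norm_pos_iff.2 (sub_ne_zero.2 hi)
  have := hM i
  positivity

theorem IsTrajectory.hasDerivWithinAt_objective (H : Admissible Q φ k α R)
    {P : ℝ → Positions N d} (hP : IsTrajectory Q φ k α R kprop P) {t : ℝ} (ht : 0 ≤ t)
    (hdist : ∀ i j, i ≠ j → P t i ≠ P t j) (hM : ∀ i, 0 < cellMass Q φ k α R (P t) i) :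
    HasDerivWithinAt (fun s => objective Q φ k α R (P s))
      (2 * α * kprop * deviation Q φ k α R (P t)) (Set.Ici 0) t := by
  have hPd : HasDerivWithinAt P (fun i => control Q φ k α R kprop (P t) i) (Set.Ici 0) t :=
    hasDerivWithinAt_pi.2 (hP t ht)
  refine ((hasFDerivAt_objective H hdist).comp_hasDerivWithinAt t hPd).congr_deriv ?_
  rw [sum_apply, deviation, Finset.mul_sum]
  refine Finset.sum_congr rfl fun i _ => ?_
  rw [← cellMass_smul_cellCentroid H (hM i), ← smul_sub, innerProj_apply, control,
    inner_neg_right, real_inner_smul_left, real_inner_smul_left, real_inner_smul_right,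
    real_inner_self_eq_norm_sq]
  ring

/-- Every trajectory converges to the set of critical points. -/
theorem IsTrajectory.tendsto_infEDist (H : Admissible Q φ k α R) (hkprop : 0 < kprop)
    (hmass : ∀ P ∈ configurations N Q, ∀ i, 0 < cellMass Q φ k α R P i)
    {P : ℝ → Positions N d} (hP : IsTrajectory Q φ k α R kprop P)
    (h0 : P 0 ∈ configurations N Q) :
    Tendsto (fun t => Metric.infEDist (P t) (criticalPoints N Q φ k α R)) atTop (𝓝 0) := by
  have hα := H.α_pos
  have hcfg : ∀ t, 0 ≤ t → P t ∈ configurations N Q := fun t ht =>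
    hP.mem_configurations H hkprop hmass h0 ht
  obtain ⟨η, hη, hsep⟩ := hP.exists_le_norm_sub H hkprop hmass h0
  set K : Set (Positions N d) :=
    (Set.univ.pi fun _ : Fin N => Q) ∩ {P | ∀ i j, i ≠ j → η ≤ ‖P i - P j‖} with hKdef
  have hK : IsCompact K := by
    refine (isCompact_univ_pi fun _ => H.isCompact).inter_right ?_
    simp only [Set.ofPred_forall]
    refine isClosed_iInter fun i => isClosed_iInter fun j => isClosed_iInter fun _ =>
      isClosed_le continuous_const ?_
    exact ((continuous_apply i).sub (continuous_apply j)).norm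
  have hKcfg : K ⊆ configurations N Q := fun P' hP' => ⟨fun i => hP'.1 i (Set.mem_univ i),
    fun i j hij h => by
      have := hP'.2 i j hij
      rw [h, sub_self, norm_zero] at this
      exact this.not_gt hη⟩
  have hPK : ∀ t, 0 ≤ t → P t ∈ K := fun t ht =>
    ⟨fun i _ => (hcfg t ht).1 i, fun i j hij => hsep t ht i j hij⟩
  -- the objective function converges along the trajectory
  set h : ℝ → ℝ := fun t => objective Q φ k α R (P t) with hh
  have hder : ∀ t, 0 ≤ t → HasDerivWithinAt h (2 * α * kprop * deviation Q φ k α R (P t))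
      (Set.Ici 0) t := fun t ht =>
    hP.hasDerivWithinAt_objective H ht (hcfg t ht).2 (hmass _ (hcfg t ht))
  have hgrow : ∀ {c s t : ℝ}, 0 ≤ s → s ≤ t → (∀ r ∈ Set.Icc s t, c ≤ deviation Q φ k α R (P r)) →
      2 * α * kprop * c * (t - s) ≤ h t - h s := by
    intro c s t hs hst hc
    refine (convex_Icc s t).mul_sub_le_image_sub_of_le_deriv
      (fun r hr => ((hder r (hs.trans hr.1)).continuousWithinAt).mono
        fun x hx => hs.trans hx.1) (fun r hr => ?_) (fun r hr => ?_) s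
      (Set.left_mem_Icc.2 hst) t (Set.right_mem_Icc.2 hst) hst
    all_goals
      rw [interior_Icc] at hr
      have hr0 : 0 < r := hs.trans_lt hr.1
      have hd := (hder r hr0.le).hasDerivAt (Ici_mem_nhds hr0)
    · exact hd.differentiableAt.differentiableWithinAt
    · rw [hd.deriv]
      exact mul_le_mul_of_nonneg_left (hc r (Set.Ioo_subset_Icc_self hr)) (by positivity)
  have hmono : MonotoneOn h (Set.Ici 0) := fun s hs t _ hst => by
    have := hgrow (c := 0) hs hst fun r hr =>
      deviation_nonneg (hmass _ (hcfg r (le_trans hs hr.1)))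
    linarith
  obtain ⟨b, hb⟩ : BddAbove (objective Q φ k α R '' K) :=
    (hK.image_of_continuousOn fun P' hP' =>
      (hasFDerivAt_objective H (hKcfg hP').2).continuousAt.continuousWithinAt).bddAbove
  -- Freezing the time at `0` for negative `t` makes the function monotone on the whole line.
  obtain ⟨L, hL⟩ : ∃ L, Tendsto (fun t => h (max t 0)) atTop (𝓝 L) := by
    refine ⟨_, tendsto_atTop_ciSup (fun s t hst => hmono (le_max_right s 0) (le_max_right t 0)
      (max_le_max hst le_rfl)) ⟨b, ?_⟩⟩
    rintro _ ⟨t, rfl⟩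
    exact hb ⟨_, hPK _ (le_max_right _ _), rfl⟩
  replace hL : Tendsto h atTop (𝓝 L) := hL.congr' <| by
    filter_upwards [eventually_ge_atTop 0] with t ht
    rw [max_eq_left ht]
  -- the speed of the robots is bounded
  obtain ⟨v, hv, hspeed⟩ : ∃ v, 0 < v ∧ ∀ s t, 0 ≤ s → s ≤ t → dist (P t) (P s) ≤ v * (t - s) := by
    obtain ⟨D, hD⟩ := H.isCompact.isBounded.exists_norm_le
    refine ⟨kprop * (2 * max D 1), by positivity, fun s t hs hst => ?_⟩
    refine (dist_pi_le_iff (mul_nonneg (by positivity) (sub_nonneg.2 hst))).2 fun i => ?_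
    have := (convex_Ici (0 : ℝ)).norm_image_sub_le_of_norm_hasDerivWithin_le
      (f := fun t => P t i) (C := kprop * (2 * max D 1)) (fun r hr => hP r hr i) (fun r hr => ?_)
      (x := s) hs (y := t) (hs.trans hst)
    · rwa [Real.norm_eq_abs, abs_of_nonneg (sub_nonneg.2 hst), ← dist_eq_norm] at this
    · have h1 := hD _ ((hcfg r hr).1 i)
      have h2 := hD _ (cellCentroid_mem H (hmass _ (hcfg r hr) i))
      rw [control, norm_neg, norm_smul, Real.norm_eq_abs, abs_of_pos hkprop]
      refine mul_le_mul_of_nonneg_left ((norm_sub_le _ _).trans ?_) hkprop.le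
      have := le_max_left D 1
      linarith
  rw [ENNReal.tendsto_atTop_zero]
  -- Otherwise some times `τ n → ∞` keep the positions at a fixed distance from the critical set,
  -- and a limit point `P'` has positive deviation. If that set were empty, the distance would be
  -- `⊤`, so the same argument also shows that it is non-empty.
  by_contra! hbad
  obtain ⟨ε, hε, hbad⟩ := hbad
  choose τ hτ hτε using fun n : ℕ => hbad n
  have hτ0 : ∀ n, 0 ≤ τ n := fun n => n.cast_nonneg.trans (hτ n)
  have hτtop : Tendsto τ atTop atTop := tendsto_atTop_mono hτ tendsto_natCast_atTop_atTop
  obtain ⟨P', hP'K, ψ, hψ, hlim⟩ := hK.tendsto_subseq fun n => hPK _ (hτ0 n)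
  have hP' := hKcfg hP'K
  have hP'ε : ε ≤ Metric.infEDist P' (criticalPoints N Q φ k α R) :=
    ge_of_tendsto' ((Metric.continuous_infEDist.tendsto P').comp hlim) fun n => (hτε (ψ n)).le
  have hncrit : P' ∉ criticalPoints N Q φ k α R := fun hmem => by
    rw [Metric.infEDist_zero_of_mem hmem] at hP'ε
    exact hε.not_ge hP'ε
  obtain ⟨i, hi⟩ : ∃ i, P' i ≠ cellCentroid Q φ k α R P' i := by
    by_contra! hall
    rw [criticalPoints_eq H hmass] at hncrit
    exact hncrit ⟨hP', hall⟩
  have hdev := deviation_pos (hmass _ hP') hi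
  obtain ⟨c, hc, hcdev⟩ := exists_between hdev
  obtain ⟨δ, hδ, hball⟩ := Metric.eventually_nhds_iff.1
    ((continuousAt_deviation H hP'.2 (hmass _ hP')).eventually (lt_mem_nhds hcdev))
  -- During a time `σ` the robots move by at most `δ / 2`. Starting within `δ / 2` of `P'`, they
  -- stay where the deviation exceeds `c`, and the objective rises by a fixed amount infinitely
  -- often, against its convergence.
  set σ := δ / (2 * v) with hσ
  have hσ0 : 0 < σ := by positivity
  have hrise : ∀ᶠ n in atTop, 2 * α * kprop * c * σ ≤ h (τ (ψ n) + σ) - h (τ (ψ n)) := by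
    filter_upwards [(Metric.tendsto_nhds.1 hlim) (δ / 2) (by positivity)] with n hn
    have := hgrow (c := c) (hτ0 (ψ n)) (le_add_of_nonneg_right hσ0.le) fun r hr => (hball ?_).le
    · rwa [add_sub_cancel_left] at this
    · have h1 := hspeed _ r (hτ0 (ψ n)) hr.1
      have h2 : v * (r - τ (ψ n)) ≤ δ / 2 := by
        calc v * (r - τ (ψ n)) ≤ v * σ := by gcongr; linarith [hr.2]
          _ = δ / 2 := by rw [hσ]; field_simp
      have h3 := dist_triangle (P r) (P (τ (ψ n))) P'
      simp only [Function.comp_apply] at hn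
      linarith
  have hψτ : Tendsto (fun n => τ (ψ n)) atTop atTop := hτtop.comp hψ.tendsto_atTop
  have hzero : Tendsto (fun n => h (τ (ψ n) + σ) - h (τ (ψ n))) atTop (𝓝 (L - L)) :=
    (hL.comp (tendsto_atTop_add_const_right _ σ hψτ)).sub (hL.comp hψτ)
  have := ge_of_tendsto hzero hrise
  rw [sub_self] at this
  exact this.not_gt (by positivity)

end Convergence

end RangeSearch

end

theorem mainTheorem4 (N d : ℕ) (Q : Set (RangeSearch.Space d))
    (hQ : RangeSearch.IsConvexPolytope Q)
    (φ : RangeSearch.Space d → ℝ) (hφ : ∀ q ∈ Q, φ q ∈ Set.Icc (0 : ℝ) 1)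
    (hφm : AEMeasurable φ (volume.restrict Q))
    (k α R kprop : ℝ) (hk : k ∈ Set.Ioo (0 : ℝ) 1) (hα : 0 < α) (hR : 0 < R)
    (hkprop : 0 < kprop)
    -- the centroids in the control law are defined
    (hmass : ∀ P ∈ RangeSearch.configurations N Q, ∀ i,
      0 < RangeSearch.cellMass Q φ k α R P i) :
    -- the critical points are the configurations of robots placed at the centroids
    RangeSearch.criticalPoints N Q φ k α R =
        {P | P ∈ RangeSearch.configurations N Q ∧
          ∀ i, P i = RangeSearch.cellCentroid Q φ k α R P i} ∧
      -- every trajectory converges to the set of critical points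
      ∀ P : ℝ → RangeSearch.Positions N d,
        RangeSearch.IsTrajectory Q φ k α R kprop P →
        P 0 ∈ RangeSearch.configurations N Q →
        (∀ t : ℝ, 0 ≤ t → P t ∈ RangeSearch.configurations N Q) ∧
        Tendsto (fun t => Metric.infEDist (P t) (RangeSearch.criticalPoints N Q φ k α R))
          atTop (𝓝 0) := by
  obtain ⟨s, hs, rfl⟩ := hQ
  have H : RangeSearch.Admissible (convexHull ℝ s) φ k α R :=
    ⟨hs.isCompact_convexHull ℝ, convex_convexHull ℝ s, hφ, hφm, hk.1, hα, hR⟩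
  exact ⟨RangeSearch.criticalPoints_eq H hmass, fun P hP h0 =>
    ⟨fun t ht => hP.mem_configurations H hkprop hmass h0 ht,
      hP.tendsto_infEDist H hkprop hmass h0⟩⟩
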